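/- Modules are unit squares occupying cells of the infinite square grid $\mathbb{Z}^2$. A configuration of $n$ modules is a set of $n$ cells, considered up to translation, and it is facet-connected if the graph joining cells that share an edge is connected on it. A restrictive (Set 1) pivoting move takes a module $a$ that shares an edge with a module $s$ and rotates it about one of the two endpoints $v$ of that edge: by $90^\circ$ if the cell $s'$ sharing with $s$ the other edge of $s$ at $v$ is occupied (so that $a$ ends up edge-adjacent to $s'$), and by $180^\circ$, ending in the cell $s'$, if $s'$ is empty. Every cell whose interior is met by the rotating square, other than the starting cell of $a$, must be empty, and the configuration without $a$ must be facet-connected. Let $\mathcal{G}_n$ be the graph whose nodes are the facet-connected configurations of $n$ modules, two of them being adjacent if one restrictive pivoting move transforms one into the other. Up to rotations and reflections of the grid, consider three patterns, where $\bullet$ is a module and $\times$ an empty cell. Pattern $\Gamma$ is the $2\times2$ square $\begin{smallmatrix}\times&\bullet\\ \bullet&\times\end{smallmatrix}$. Pattern I is the $1\times 3$ row $\bullet\times\bullet$. Pattern Z is the Z-shaped tetromino whose two end cells are modules and whose two middle cells are empty. A configuration contains only pattern Z if it contains pattern Z but neither pattern $\Gamma$ nor pattern I. **Theorem.** There are a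 real number $c>1$ and an integer $N$ such that for every $n\ge N$ the graph $\mathcal{G}_n$ has at least $c^n$ distinct connected components $K$ with the following two properties. First, $K$ is locked: it contains no straight (horizontal or vertical) strip of $n$ modules. Second, $K$ contains a set of at least $c^n$ configurations that contain only pattern Z, any two of which can be reconfigured into each other by restrictive pivoting moves through configurations that contain only pattern Z. In particular each such $K$ has at least $c^n$ nodes. -/

import Mathlib

namespace PivotingSquares

/-- Positions of the infinite square grid. -/
abbrev Cell := ℤ × ℤ

/-- The four unit vectors North, East, South, West. -/
def IsDir (d : Cell) : Prop :=
  d = (1, 0) ∨ d = (-1, 0) ∨ d = (0, 1) ∨ d = (0, -1)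

/-- Two unit vectors that are perpendicular to each other. -/
def IsFrame (d e : Cell) : Prop :=
  IsDir d ∧ IsDir e ∧ d.1 * e.1 + d.2 * e.2 = 0

/-- Facet-adjacency of grid positions: the two unit squares share an edge. -/
def facetGraph : SimpleGraph Cell :=
  SimpleGraph.fromRel fun a b => IsDir (b - a)

/-- The facet-adjacency graph of the set of modules `C` is connected. -/
def FacetConnected (C : Finset Cell) : Prop :=
  (facetGraph.induce (C : Set Cell)).Connected

/-- A single pivoting move of the restrictive set.

The moving module `a` is facet-adjacent to the module `s = a + d` and rotates about the vertex
of their common edge on the side `e`.  The modules other than `a` must be facet-connected, and every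
grid position whose interior is met by the rotating square must be empty.

* If `s' = s + e` is a module, the rotation is by 90 degrees and `a` ends on `a + e`, next to `s'`;
  it sweeps `a + e`, `a - d` and `a + e - d`.
* If `s + e` is empty, the rotation is by 180 degrees and `a` ends on `s + e`; in addition it
  sweeps `a + 2e`, `s + 2e` and `s + e`. -/
def RestrictiveMove (C D : Finset Cell) : Prop :=
  ∃ a d e : Cell, IsFrame d e ∧ a ∈ C ∧ a + d ∈ C ∧ FacetConnected (C.erase a) ∧
    a + e ∉ C ∧ a - d ∉ C ∧ a + e - d ∉ C ∧
    ((a + d + e ∈ C ∧ D = insert (a + e) (C.erase a)) ∨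
      (a + d + e ∉ C ∧ a + e + e ∉ C ∧ a + d + e + e ∉ C ∧
        D = insert (a + d + e) (C.erase a)))

/-- Pattern Γ (corner bottleneck): two diagonally touching modules, both common neighbours empty. -/
def HasGamma (C : Finset Cell) : Prop :=
  ∃ p d e : Cell, IsFrame d e ∧ p ∈ C ∧ p + d ∉ C ∧ p + e ∉ C ∧ p + d + e ∈ C

/-- Pattern I (corridor bottleneck): module, empty position, module in a line. -/
def HasI (C : Finset Cell) : Prop :=
  ∃ p d : Cell, IsDir d ∧ p ∈ C ∧ p + d ∉ C ∧ p + d + d ∈ C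

/-- Pattern Z (wide bottleneck): a Z-shaped tetromino, in any orientation, whose two end positions
are modules and whose two middle positions are empty. -/
def HasZ (C : Finset Cell) : Prop :=
  ∃ p d e : Cell, IsFrame d e ∧ p ∈ C ∧ p + d ∉ C ∧ p + d + e ∉ C ∧ p + d + e + d ∈ C

/-- Of the three patterns, exactly pattern Z occurs. -/
def OnlyZ (C : Finset Cell) : Prop :=
  HasZ C ∧ ¬ HasGamma C ∧ ¬ HasI C

/-- A straight (horizontal or vertical) strip of modules. -/
def IsStrip (C : Finset Cell) : Prop :=
  ∃ p d : Cell, IsDir d ∧ C = (Finset.range C.card).image fun i : ℕ => p + (i : ℤ) • d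

/-- Facet-connected configurations of `n` modules, placed in the grid. -/
def Config (n : ℕ) : Type :=
  {C : Finset Cell // C.card = n ∧ FacetConnected C}

/-- Two placed configurations are the same configuration if they are translates of each other. -/
def translationSetoid (n : ℕ) : Setoid (Config n) where
  r C D := ∃ v : Cell, D.1 = C.1.image fun x => x + v
  iseqv :=
    { refl := fun C => ⟨0, by simp⟩
      symm := by
        rintro C D ⟨v, h⟩
        refine ⟨-v, ?_⟩
        rw [h, Finset.image_image]
        simp [Function.comp_def]
      trans := by
        rintro C D E ⟨v, h⟩ ⟨w, h'⟩
        refine ⟨v + w, ?_⟩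
        rw [h', h, Finset.image_image]
        simp [Function.comp_def, add_assoc] }

/-- Facet-connected configurations of `n` modules up to translation. -/
def Shape (n : ℕ) : Type := Quotient (translationSetoid n)

/-- The shape of a placed configuration. -/
def Config.shape {n : ℕ} (C : Config n) : Shape n := Quotient.mk (translationSetoid n) C

/-- The reconfiguration graph on configurations of `n` modules for the restrictive set of moves. -/
def reconfGraph (n : ℕ) : SimpleGraph (Shape n) :=
  SimpleGraph.fromRel fun S T =>
    ∃ C D : Config n, C.shape = S ∧ D.shape = T ∧ RestrictiveMove C.1 D.1

/-- The nodes of the reconfiguration graph that contain only pattern Z. -/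
def onlyZShapes (n : ℕ) : Set (Shape n) :=
  {S | ∃ C : Config n, C.shape = S ∧ OnlyZ C.1}

/-- The nodes of the reconfiguration graph that are straight strips. -/
def stripShapes (n : ℕ) : Set (Shape n) :=
  {S | ∃ C : Config n, C.shape = S ∧ IsStrip C.1}

/-- The set `s` has at least `x` elements. -/
def HasAtLeast {α : Type*} (s : Set α) (x : ℝ) : Prop :=
  ∃ T : Finset α, (T : Set α) ⊆ s ∧ x ≤ (T.card : ℝ)

end PivotingSquares

/-! A *comb* is a horizontal line of modules that carries gadgets on vertical stems. A gadget has 24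
states, which are closed under the moves inside it; its walls and the line consist of modules that
are blocked or cut vertices, so every reconfiguration of a comb only changes the states of its
gadgets. Two of the states contain only pattern Z and are connected by a move. -/

namespace PivotingSquares

/-! The argument builds configurations that are rigid except for small independent switches. In
state `stateA` a gadget is one long path of modules. From its stem the path runs around a cavity and
ends inside that cavity, at the cell `(5, 7)`. A module with modules on two opposite sides cannot
pivot, and a cut vertex may not move, so only modules near the tip are mobile. The mouth of the
cavity, between `(6, 4)` and `(8, 5)`, is itself an occurrence of pattern Z. That the tip never gets
out is checked exhaustively: the 24 masks in `states`, which differ only in rows 5 to 8, are closed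
under every pivot not ruled out by a cut certificate (`states_stateOK`).

The passage from one gadget to a whole comb is local. Gadgets are so far apart that a pivot of a
gadget module above the two stem rows sees only its own gadget (`mem_comb_local`, `okFrame_sound`).
Each gadget meets the rest only at its foot, so a cut inside the gadget is a cut of the comb. The
modules of the line and of the stems are blocked or are cut vertices. Hence a move only changes the
state of one gadget (`comb_move`), and the offsets of the gadgets are invariants of a component.
They can be read off from the row just above the line (`exists_combShapes_inter`).

The count uses two independent sources of binary choices. Displacing the inner gadgets by 0 or 1
gives `2 ^ (m - 2)` components, none containing a strip. Within each, the gadgets can be switched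
separately from `stateA` to `stateB` without creating Γ or I (`comb_switch`, `comb_onlyZ`), which
gives `2 ^ m` nodes connected through configurations that contain only pattern Z. Since `m` is about
`n / 66`, both numbers are exponential in `n`. -/

/-! ### Directions, connectivity and reversibility of moves -/

theorem IsDir.neg {d : Cell} (h : IsDir d) : IsDir (-d) := by
  rcases h with rfl | rfl | rfl | rfl <;> simp [IsDir]

theorem IsDir.ne_zero {d : Cell} (h : IsDir d) : d ≠ 0 := by
  rcases h with rfl | rfl | rfl | rfl <;> simp

theorem facetGraph_adj {a b : Cell} : facetGraph.Adj a b ↔ IsDir (b - a) := by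
  simp only [facetGraph, SimpleGraph.fromRel_adj]
  constructor
  · rintro ⟨-, h | h⟩
    · exact h
    · simpa using h.neg
  · intro h
    refine ⟨?_, Or.inl h⟩
    rintro rfl
    exact h.ne_zero (sub_self a)

/-- The eight frames, listed explicitly. -/
theorem IsFrame.cases {d e : Cell} (h : IsFrame d e) :
    ((d = (1, 0) ∨ d = (-1, 0)) ∧ (e = (0, 1) ∨ e = (0, -1))) ∨
      ((d = (0, 1) ∨ d = (0, -1)) ∧ (e = (1, 0) ∨ e = (-1, 0))) := by
  obtain ⟨hd, he, h⟩ := h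
  rcases hd with rfl | rfl | rfl | rfl <;> rcases he with rfl | rfl | rfl | rfl <;>
    first | (exfalso; revert h; decide) | simp

theorem IsFrame.neg_right {d e : Cell} (h : IsFrame d e) : IsFrame d (-e) :=
  ⟨h.1, h.2.1.neg, by have := h.2.2; simp only [Prod.fst_neg, Prod.snd_neg]; linarith⟩

theorem IsFrame.neg_swap {d e : Cell} (h : IsFrame d e) : IsFrame (-e) (-d) :=
  ⟨h.2.1.neg, h.1.neg, by have := h.2.2; simp only [Prod.fst_neg, Prod.snd_neg]; linarith⟩

/-- A facet-closed part of a connected configuration that contains one module contains all. -/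
theorem FacetConnected.subset_of_closed {C : Finset Cell} (hC : FacetConnected C) {S : Set Cell}
    (hS : ∀ p ∈ C, p ∈ S → ∀ q ∈ C, IsDir (q - p) → q ∈ S) {p₀ : Cell} (hp₀ : p₀ ∈ C)
    (hp₀S : p₀ ∈ S) : ∀ q ∈ C, q ∈ S := by
  intro q hq
  obtain ⟨w⟩ := hC.preconnected ⟨p₀, hp₀⟩ ⟨q, hq⟩
  suffices H : ∀ (x y : (C : Set Cell)), (facetGraph.induce (C : Set Cell)).Walk x y →
      (x : Cell) ∈ S → (y : Cell) ∈ S from H _ _ w hp₀S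
  intro x y w
  induction w with
  | nil => exact id
  | @cons u v w' h p ih =>
    intro hu
    exact ih (hS u u.2 hu v v.2 (facetGraph_adj.1 h))

/-- Facet-adjacency inside `C`. -/
def Step (C : Finset Cell) (p q : Cell) : Prop := q ∈ C ∧ IsDir (q - p)

theorem facetConnected_of_reach {C : Finset Cell} {r : Cell} (hr : r ∈ C)
    (h : ∀ p ∈ C, Relation.ReflTransGen (Step C) r p) : FacetConnected C := by
  have key : ∀ p, Relation.ReflTransGen (Step C) r p → ∃ hp : p ∈ C,
      (facetGraph.induce (C : Set Cell)).Reachable ⟨r, hr⟩ ⟨p, hp⟩ := by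
    intro p hp
    induction hp with
    | refl => exact ⟨hr, SimpleGraph.Reachable.refl _⟩
    | @tail b c _ hbc ih =>
      obtain ⟨hb, hreach⟩ := ih
      refine ⟨hbc.1, hreach.trans (SimpleGraph.Adj.reachable ?_)⟩
      exact facetGraph_adj.2 hbc.2
  refine (SimpleGraph.connected_iff_exists_forall_reachable _).2 ⟨⟨r, hr⟩, ?_⟩
  rintro ⟨p, hp⟩
  exact (key p (h p hp)).2

/-- The reverse rotation sweeps the same cells. A 90° turn is undone with the frame `(d, -e)`. After
a 180° turn the anchor lies in direction `-e` from the module, so the frame becomes `(-e, -d)`. This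
makes the symmetrization in `reconfGraph` harmless. -/
theorem RestrictiveMove.symm {C D : Finset Cell} (h : RestrictiveMove C D) :
    RestrictiveMove D C := by
  obtain ⟨a, d, e, hf, ha, hs, hc, hae, had, haed, h⟩ := h
  have hd0 := hf.1.ne_zero
  have he0 := hf.2.1.ne_zero
  have hde : d ≠ e ∧ d ≠ -e ∧ d + e ≠ 0 ∧ d + e + e ≠ 0 ∧ d + d + e ≠ 0 := by
    rcases hf.cases with ⟨rfl | rfl, rfl | rfl⟩ | ⟨rfl | rfl, rfl | rfl⟩ <;> decide
  have hee : e + e ≠ 0 ∧ d + d ≠ 0 := by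
    rcases hf.cases with ⟨rfl | rfl, rfl | rfl⟩ | ⟨rfl | rfl, rfl | rfl⟩ <;> decide
  rcases h with ⟨h1, rfl⟩ | ⟨h1, h2, h3, rfl⟩
  · have hE : (insert (a + e) (C.erase a)).erase (a + e) = C.erase a :=
      Finset.erase_insert (by simp [hae])
    refine ⟨a + e, d, -e, hf.neg_right, Finset.mem_insert_self _ _, ?_, by rwa [hE], ?_, ?_, ?_,
      Or.inl ⟨?_, ?_⟩⟩
    · rw [show a + e + d = a + d + e by abel]
      simp only [Finset.mem_insert, Finset.mem_erase]
      exact Or.inr ⟨by simp [add_assoc, hde], h1⟩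
    · simp [he0]
    · simp [haed]
      exact hd0
    · rw [show a + e + -e - d = a - d by abel]
      simp only [Finset.mem_insert, Finset.mem_erase, had, and_false, or_false]
      intro h
      exact hde.2.2.1 (by rw [show d + e = a + e - (a - d) by abel, ← h, sub_self])
    · rw [show a + e + d + -e = a + d by abel]
      simp [hs, hd0]
    · rw [hE]; simp [ha]
  · have hE : (insert (a + d + e) (C.erase a)).erase (a + d + e) = C.erase a :=
      Finset.erase_insert (by simp [h1])
    refine ⟨a + d + e, -e, -d, hf.neg_swap, Finset.mem_insert_self _ _, ?_, by rwa [hE], ?_, ?_,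
      ?_, Or.inr ⟨?_, ?_, ?_, ?_⟩⟩
    · simp [hs, hd0]
    · rw [show a + d + e + -d = a + e by abel]
      simp [hae, hd0]
    · rw [show a + d + e - -e = a + d + e + e by abel]
      simp [h3, he0]
    · rw [show a + d + e + -d - -e = a + e + e by abel]
      simp only [Finset.mem_insert, Finset.mem_erase, h2, and_false, or_false]
      intro h
      exact hde.1 (by rw [← sub_eq_zero, show d - e = a + d + e - (a + e + e) by abel, ← h, sub_self])
    · rw [show a + d + e + -e + -d = a by abel]
      simp [add_assoc, hde]
    · rw [show a + d + e + -d + -d = a + e - d by abel]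
      simp only [Finset.mem_insert, Finset.mem_erase, haed, and_false, or_false]
      intro h
      exact hee.2 (by rw [show d + d = a + d + e - (a + e - d) by abel, ← h, sub_self])
    · rw [show a + d + e + -e + -d + -d = a - d by abel]
      simp only [Finset.mem_insert, Finset.mem_erase, had, and_false, or_false]
      intro h
      exact hde.2.2.2.2 (by rw [show d + d + e = a + d + e - (a - d) by abel, ← h, sub_self])
    · rw [hE]
      simp [ha]

/-! ### Translations -/

/-- Translation of a configuration. -/
def translate (v : Cell) (C : Finset Cell) : Finset Cell := C.image fun x => x + v

theorem mem_translate {v p : Cell} {C : Finset Cell} : p ∈ translate v C ↔ p - v ∈ C := by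
  simp only [translate, Finset.mem_image]
  constructor
  · rintro ⟨x, hx, rfl⟩
    simpa using hx
  · intro h
    exact ⟨_, h, by simp⟩

theorem mem_translate_add {v p : Cell} {C : Finset Cell} : p + v ∈ translate v C ↔ p ∈ C := by
  simp [mem_translate]

theorem translate_erase (v a : Cell) (C : Finset Cell) :
    translate v (C.erase a) = (translate v C).erase (a + v) := by
  ext p
  simp only [mem_translate, Finset.mem_erase, ne_eq, sub_eq_iff_eq_add]

theorem translate_insert (v a : Cell) (C : Finset Cell) :
    translate v (insert a C) = insert (a + v) (translate v C) := by
  ext p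
  simp only [mem_translate, Finset.mem_insert, sub_eq_iff_eq_add]

theorem FacetConnected.translate {C : Finset Cell} (h : FacetConnected C) (v : Cell) :
    FacetConnected (translate v C) := by
  obtain ⟨r, hr⟩ := h.nonempty
  refine facetConnected_of_reach (r := r + v) (mem_translate_add.2 hr) ?_
  intro p hp
  have := h.subset_of_closed
    (S := {q | Relation.ReflTransGen (Step (PivotingSquares.translate v C)) (r + v) (q + v)}) ?_ hr
    Relation.ReflTransGen.refl (p - v) (mem_translate.1 hp)
  · simpa using this
  · intro p hp hS q hq hd
    exact Relation.ReflTransGen.tail hS ⟨mem_translate_add.2 hq, by simpa using hd⟩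

theorem RestrictiveMove.translate {C D : Finset Cell} (h : RestrictiveMove C D) (v : Cell) :
    RestrictiveMove (translate v C) (translate v D) := by
  obtain ⟨a, d, e, hf, ha, hs, hc, hae, had, haed, h⟩ := h
  have tr : ∀ q : Cell, ∀ p, p = q + v → (p ∈ PivotingSquares.translate v C ↔ q ∈ C) := by
    rintro q p rfl
    exact mem_translate_add
  refine ⟨a + v, d, e, hf, (tr a _ rfl).2 ha, (tr (a + d) _ (by abel)).2 hs, ?_,
    mt (tr (a + e) _ (by abel)).1 hae, mt (tr (a - d) _ (by abel)).1 had,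
    mt (tr (a + e - d) _ (by abel)).1 haed, ?_⟩
  · rw [← translate_erase]
    exact hc.translate v
  · rcases h with ⟨h1, rfl⟩ | ⟨h1, h2, h3, rfl⟩
    · refine Or.inl ⟨(tr (a + d + e) _ (by abel)).2 h1, ?_⟩
      rw [translate_insert, translate_erase]
      congr 1
      abel
    · refine Or.inr ⟨mt (tr (a + d + e) _ (by abel)).1 h1, mt (tr (a + e + e) _ (by abel)).1 h2,
        mt (tr (a + d + e + e) _ (by abel)).1 h3, ?_⟩
      rw [translate_insert, translate_erase]
      congr 1
      abel

/-- A module with modules on two opposite sides is blocked. -/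
theorem no_move_of_opposite_neighbours {C : Finset Cell} {a d e u : Cell} (hf : IsFrame d e) (hu : IsDir u)
    (h1 : a + u ∈ C) (h2 : a - u ∈ C) (hae : a + e ∉ C) (had : a - d ∉ C) : False := by
  have key : u = d ∨ u = -d ∨ u = e ∨ u = -e := by
    rcases hf.cases with ⟨rfl | rfl, rfl | rfl⟩ | ⟨rfl | rfl, rfl | rfl⟩ <;>
      rcases hu with rfl | rfl | rfl | rfl <;> decide
  rcases key with rfl | rfl | rfl | rfl
  · exact had h2
  · exact had (by simpa [sub_eq_add_neg] using h1)
  · exact hae h1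
  · exact hae (by simpa using h2)

/-! ### Gadget states as bit masks, and the finite computations -/

/-- The cell `(x, y)` of the `12 × 14` box `[2, 13] × [0, 13]` is marked in the bit mask `M`. -/
def occ (M : ℕ) (x y : ℤ) : Bool :=
  decide (2 ≤ x) && decide (x ≤ 13) && decide (0 ≤ y) && decide (y ≤ 13) &&
    M.testBit (16 * y + x).toNat

/-- The bit mask of a single cell. -/
def cellMask (x y : ℤ) : ℕ := 2 ^ (16 * y + x).toNat

/-- All cells sharing an edge with a cell of the mask `F`, together with `F` itself. -/
def expand (F : ℕ) : ℕ :=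
  F ||| (F <<< 1 ||| F >>> 1 ||| (F <<< 16 ||| F >>> 16))

/-- Flood filling inside the mask `M`, starting from `F`. -/
def flood (M : ℕ) : ℕ → ℕ → ℕ
  | 0, F => F
  | k + 1, F => flood M k (expand F &&& M)

/-- The box that contains all gadget cells. -/
def boxList : List (ℤ × ℤ) :=
  [13, 12, 11, 10, 9, 8, 7, 6, 5, 4, 3, 2, 1, 0].flatMap fun y =>
    [2, 3, 4, 5, 6, 7, 8, 9, 10, 11, 12, 13].map fun x => (x, y)

/-- The cells of `M` that are cut off from the foot `(13, 0)` of the stem when `(x, y)` is removed. -/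
def cutOff (M : ℕ) (x y : ℤ) : ℕ :=
  (M ^^^ cellMask x y) ^^^ flood (M ^^^ cellMask x y) 48 (cellMask 13 0)

/-- A certificate that removing `(x, y)` from the gadget state `M` cuts off some cells. -/
def isCut (M : ℕ) (x y : ℤ) : Bool :=
  boxList.any (fun p => occ (cutOff M x y) p.1 p.2) &&
    (expand (cutOff M x y) &&& (M ^^^ cellMask x y)).beq (cutOff M x y) &&
    ((cutOff M x y) &&& 0xFFFF).beq 0

/-- The gadget state obtained from `M` by moving the module at `(x, y)` to `(x', y')`. -/
def shift (M : ℕ) (x y x' y' : ℤ) : ℕ := M ^^^ cellMask x y ^^^ cellMask x' y'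

/-- The 24 states of a gadget that can be reached by moves inside the gadget. -/
def states : List ℕ :=
  [0xfc018403040e0408e409840f04007c00c03f8020002000, 0xfc018403040e4408c409840f04007c00c03f8020002000,
   0xfc018403040e0408c409c40f04007c00c03f8020002000, 0xfc018403040e8408c409840f04007c00c03f8020002000,
   0xfc018403040e84088409c40f04007c00c03f8020002000, 0xfc018403040e04088409e40f04007c00c03f8020002000,
   0xfc018403040e44084409c40f04007c00c03f8020002000, 0xfc018403040e04094409c40f04007c00c03f8020002000,
   0xfc018403040ec4088409840f04007c00c03f8020002000, 0xfc018403040e04090409e40f04007c00c03f8020002000,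
   0xfc018403040e04084409e40f04007c00c03f8020002000, 0xfc018403040e04086409c40f04007c00c03f8020002000,
   0xfc018403040e04098409c40f04007c00c03f8020002000, 0xfc018403040e04082409e40f04007c00c03f8020002000,
   0xfc018403040e0409c409840f04007c00c03f8020002000, 0xfc018403040e04080409f40f04007c00c03f8020002000,
   0xfc018403040e84098409840f04007c00c03f8020002000, 0xfc018403040e0409c409040f84007c00c03f8020002000,
   0xfc018403040e0409c409440f04007c00c03f8020002000, 0xfc018403040e84098409040f84007c00c03f8020002000,
   0xfc018403040e8409c409040f04007c00c03f8020002000, 0xfc018403040e0409e409040f04007c00c03f8020002000,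
   0xfc018403040ec4098409040f04007c00c03f8020002000, 0xfc018403040e4409c409040f04007c00c03f8020002000]

/-- The module at `(x, y)` may be moved to `(x', y')` within the list of gadget states. -/
def okTarget (M : ℕ) (x y x' y' : ℤ) : Bool :=
  decide (2 ≤ x') && decide (x' ≤ 13) && decide (0 ≤ y') && decide (y' ≤ 13) &&
    states.any (Nat.beq (shift M x y x' y'))

/-- Every rotation of `(x, y)` about `(x + dx, y + dy)` on the side `(ex, ey)` is either blocked or
leads to a gadget state. -/
def okFrame (M : ℕ) (x y dx dy ex ey : ℤ) : Bool :=
  !occ M (x + dx) (y + dy) || occ M (x + ex) (y + ey) || occ M (x - dx) (y - dy) ||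
    occ M (x + ex - dx) (y + ey - dy) ||
    bif occ M (x + dx + ex) (y + dy + ey) then okTarget M x y (x + ex) (y + ey)
    else occ M (x + ex + ex) (y + ey + ey) || occ M (x + dx + ex + ex) (y + dy + ey + ey) ||
      okTarget M x y (x + dx + ex) (y + dy + ey)

/-- No rotation of the module `(x, y)` leads out of the list of gadget states. -/
def okCell (M : ℕ) (x y : ℤ) : Bool :=
  (okFrame M x y 1 0 0 1 && okFrame M x y 1 0 0 (-1) &&
    okFrame M x y (-1) 0 0 1 && okFrame M x y (-1) 0 0 (-1) &&
    okFrame M x y 0 1 1 0 && okFrame M x y 0 1 (-1) 0 &&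
    okFrame M x y 0 (-1) 1 0 && okFrame M x y 0 (-1) (-1) 0) || isCut M x y

/-- The two lowest rows of `M` consist of the stem at `x = 13`, which continues in the next row. -/
def stemOK (M : ℕ) : Bool :=
  (M &&& 0xFFFFFFFF).beq 0x20002000 && occ M 13 2

/-- The mask of the whole box `[2, 13] × [0, 13]`. -/
def boxMask : ℕ := 0x3FFC3FFC3FFC3FFC3FFC3FFC3FFC3FFC3FFC3FFC3FFC3FFC3FFC3FFC

theorem states_stemOK : states.all stemOK = true := by decide +kernel

/-- Every move inside the gadget in state `M` leads to one of the gadget states. -/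
def stateOK (M : ℕ) : Bool :=
  boxList.all fun p => !occ M p.1 p.2 || decide (p.2 < 2) || okCell M p.1 p.2

/-- This is the finite core of the locking argument. The check is conservative: a module without a
cut certificate is treated as free to move, and each of its eight frames must be blocked or lead
back into `states`. The list is split so that each state is evaluated separately. -/
theorem states_stateOK : ∀ M ∈ states, stateOK M = true := by
  unfold states
  repeat refine List.forall_mem_cons.2 ⟨by decide +kernel, ?_⟩
  exact List.forall_mem_nil _

/-- The first of the two gadget states without patterns Γ and I:
```
  ######......
  #....##.....
  #.....##....
  #......###..
  #..###...#..
  #....##..#..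
  #.....####..
  #####.......
  ....##......
  .....#######
  ...........#
  ...........#
```
The lower left corner of the picture is the cell `(2, 0)`. -/
def stateA : ℕ := 0xfc018403040e0408e409840f04007c00c03f8020002000

/-- The second of the two gadget states without patterns Γ and I: the module at `(5, 7)` has moved to
`(6, 8)`. -/
def stateB : ℕ := 0xfc018403040e4408c409840f04007c00c03f8020002000

/-- The common part of `stateA` and `stateB`. -/
def stateAB : ℕ := 0xfc018403040e0408c409840f04007c00c03f8020002000

/-- Every cell of `M` can be reached from the foot `(13, 0)` of the stem. -/
def footConnected (M : ℕ) : Bool :=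
  (flood M 48 (cellMask 13 0)).beq M && (M &&& boxMask).beq M && stemOK M

theorem footConnected_states :
    (footConnected stateA && footConnected stateB && footConnected stateAB) = true := by
  decide +kernel

/-- Neither pattern Γ nor pattern I occurs in `M`. -/
def noGammaI (M : ℕ) : Bool :=
  boxList.all fun p =>
    !occ M p.1 p.2 ||
    ([1, -1].all fun d =>
      (!occ M (p.1 + d + d) p.2 || occ M (p.1 + d) p.2) &&
      (!occ M p.1 (p.2 + d + d) || occ M p.1 (p.2 + d)) &&
      ([1, -1].all fun e =>
        !occ M (p.1 + d) (p.2 + e) || occ M (p.1 + d) p.2 || occ M p.1 (p.2 + e)))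

theorem noGammaI_states : (noGammaI stateA && noGammaI stateB) = true := by decide +kernel

/-! ### Translating bit operations into statements about cells -/

theorem occ_iff {M : ℕ} {x y : ℤ} : occ M x y = true ↔
    2 ≤ x ∧ x ≤ 13 ∧ 0 ≤ y ∧ y ≤ 13 ∧ M.testBit (16 * y + x).toNat = true := by
  simp [occ, and_assoc]

/-- Rows are 16 bits wide and only columns 2 to 13 are used, so the bit index determines the cell.
-/
theorem testBit_cellMask {x y u v : ℤ} (hx : 2 ≤ x ∧ x ≤ 13) (_hy : 0 ≤ y)
    (hu : 2 ≤ u ∧ u ≤ 13) (hv : 0 ≤ v) :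
    (cellMask x y).testBit (16 * v + u).toNat = decide (u = x ∧ v = y) := by
  rw [cellMask, Nat.testBit_two_pow]
  congr 1
  rw [eq_iff_iff]
  omega

theorem testBit_expand {F n : ℕ} : (expand F).testBit n = true ↔
    F.testBit n = true ∨ (1 ≤ n ∧ F.testBit (n - 1) = true) ∨ F.testBit (n + 1) = true ∨
      (16 ≤ n ∧ F.testBit (n - 16) = true) ∨ F.testBit (n + 16) = true := by
  simp only [expand, Nat.testBit_or, Nat.testBit_shiftLeft, Nat.testBit_shiftRight, Bool.or_eq_true,
    Bool.and_eq_true, decide_eq_true_eq, ge_iff_le, add_comm 1 n, add_comm 16 n]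
  tauto

theorem mem_boxList {x y : ℤ} (hx : 2 ≤ x ∧ x ≤ 13) (hy : 0 ≤ y ∧ y ≤ 13) : (x, y) ∈ boxList := by
  obtain ⟨hx1, hx2⟩ := hx
  obtain ⟨hy1, hy2⟩ := hy
  simp only [boxList, List.mem_flatMap, List.mem_map, Prod.mk.injEq]
  refine ⟨y, ?_, x, ?_, rfl, rfl⟩
  · interval_cases y <;> simp
  · interval_cases x <;> simp

/-- Exclusive or acts as removal followed by insertion because the bit of the source is set and that
of the target is clear. -/
theorem occ_shift {M : ℕ} {x y x' y' u v : ℤ} (h : occ M x y = true) (h' : occ M x' y' = false)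
    (hx' : 2 ≤ x' ∧ x' ≤ 13) (hy' : 0 ≤ y' ∧ y' ≤ 13) :
    occ (shift M x y x' y') u v = true ↔
      (u = x' ∧ v = y') ∨ (occ M u v = true ∧ ¬(u = x ∧ v = y)) := by
  have h0 := occ_iff.1 h
  by_cases hu : 2 ≤ u ∧ u ≤ 13 ∧ 0 ≤ v ∧ v ≤ 13
  · have hb : (shift M x y x' y').testBit (16 * v + u).toNat =
        ((M.testBit (16 * v + u).toNat ^^ decide (u = x ∧ v = y)) ^^ decide (u = x' ∧ v = y')) := by
      rw [shift, Nat.testBit_xor, Nat.testBit_xor,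
        testBit_cellMask ⟨h0.1, h0.2.1⟩ h0.2.2.1 ⟨hu.1, hu.2.1⟩ hu.2.2.1,
        testBit_cellMask hx' hy'.1 ⟨hu.1, hu.2.1⟩ hu.2.2.1]
    have e1 : occ M u v = M.testBit (16 * v + u).toNat := by simp [occ, hu]
    have e2 : occ (shift M x y x' y') u v =
        ((occ M u v ^^ decide (u = x ∧ v = y)) ^^ decide (u = x' ∧ v = y')) := by
      rw [e1, ← hb]; simp [occ, hu]
    rw [e2]
    have f1 : u = x ∧ v = y → occ M u v = true := by
      rintro ⟨rfl, rfl⟩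
      exact h
    have f2 : u = x' ∧ v = y' → occ M u v = false := by
      rintro ⟨rfl, rfl⟩
      exact h'
    obtain ⟨p, hp⟩ : ∃ p, p = decide (u = x ∧ v = y) := ⟨_, rfl⟩
    obtain ⟨q, hq⟩ : ∃ q, q = decide (u = x' ∧ v = y') := ⟨_, rfl⟩
    have hp' : (u = x ∧ v = y) ↔ p = true := by rw [hp, decide_eq_true_eq]
    have hq' : (u = x' ∧ v = y') ↔ q = true := by rw [hq, decide_eq_true_eq]
    rw [← hp, ← hq, hp', hq']
    rw [hp'] at f1
    rw [hq'] at f2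
    revert f1 f2
    cases p <;> cases q <;> cases occ M u v <;> simp
  · constructor
    · intro H
      have := occ_iff.1 H
      omega
    · rintro (H | ⟨H, -⟩)
      · omega
      · have := occ_iff.1 H
        omega

theorem stem_iff {M : ℕ} (h : stemOK M = true) (x : ℤ) :
    (occ M x 0 = true ↔ x = 13) ∧ (occ M x 1 = true ↔ x = 13) ∧ occ M 13 2 = true := by
  simp only [stemOK, Bool.and_eq_true, Nat.beq_eq] at h
  -- The constant `0x20002000` has exactly bits 13 and 29, which are column 13 in rows 0 and 1.
  have key : ∀ n : ℕ, n < 32 → M.testBit n = Nat.testBit 0x20002000 n := by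
    intro n hn
    rw [← h.1, Nat.testBit_and, show (0xFFFFFFFF : ℕ) = 2 ^ 32 - 1 by norm_num,
      Nat.testBit_two_pow_sub_one]
    simp [hn]
  refine ⟨?_, ?_, h.2⟩
  · rw [occ_iff]
    constructor
    · rintro ⟨h1, h2, -, -, h3⟩
      rw [key _ (by omega)] at h3
      interval_cases x <;> first | rfl | (exfalso; revert h3; decide)
    · rintro rfl
      refine ⟨by norm_num, by norm_num, by norm_num, by norm_num, ?_⟩
      rw [key _ (by decide)]
      decide
  · rw [occ_iff]
    constructor
    · rintro ⟨h1, h2, -, -, h3⟩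
      rw [key _ (by omega)] at h3
      interval_cases x <;> first | rfl | (exfalso; revert h3; decide)
    · rintro rfl
      refine ⟨by norm_num, by norm_num, by norm_num, by norm_num, ?_⟩
      rw [key _ (by decide)]
      decide

theorem stemOK_of_mem {M : ℕ} (h : M ∈ states) : stemOK M = true :=
  List.all_eq_true.1 states_stemOK M h

/-! ### Combs and their local structure -/

/-- The gadget in state `M`, placed above the line with horizontal offset `X`. -/
noncomputable def gadget (X : ℤ) (M : ℕ) : Finset Cell :=
  ((Finset.Icc (2 : ℤ) 13 ×ˢ Finset.Icc (0 : ℤ) 13).filter fun p => occ M p.1 p.2 = true).image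
    fun p => (X + p.1, 1 + p.2)

/-- The horizontal line that carries the gadgets `0, …, m - 1` with offsets `X`. -/
noncomputable def baseLine (m : ℕ) (X : ℕ → ℤ) : Finset Cell :=
  (Finset.Icc (X 0 + 13) (X (m - 1) + 13)).image fun x => (x, 0)

/-- A line with `m` gadgets: gadget `i` has offset `X i` and is in state `σ i`. -/
noncomputable def comb (m : ℕ) (X : ℕ → ℤ) (σ : ℕ → ℕ) : Finset Cell :=
  baseLine m X ∪ (Finset.range m).biUnion fun i => gadget (X i) (σ i)

theorem mem_gadget {X : ℤ} {M : ℕ} {a b : ℤ} :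
    (a, b) ∈ gadget X M ↔ occ M (a - X) (b - 1) = true := by
  simp only [gadget, Finset.mem_image, Finset.mem_filter, Finset.mem_product, Finset.mem_Icc,
    Prod.mk.injEq, Prod.exists]
  constructor
  · rintro ⟨x, y, ⟨-, h⟩, rfl, rfl⟩
    simpa using h
  · intro h
    have := occ_iff.1 h
    exact ⟨a - X, b - 1, ⟨⟨⟨this.1, this.2.1⟩, this.2.2.1, this.2.2.2.1⟩, h⟩, by ring, by ring⟩

theorem mem_comb {m : ℕ} {X : ℕ → ℤ} {σ : ℕ → ℕ} {a b : ℤ} :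
    (a, b) ∈ comb m X σ ↔ (b = 0 ∧ X 0 + 13 ≤ a ∧ a ≤ X (m - 1) + 13) ∨
      ∃ i < m, occ (σ i) (a - X i) (b - 1) = true := by
  simp only [comb, baseLine, Finset.mem_union, Finset.mem_image, Finset.mem_Icc, Prod.mk.injEq,
    Finset.mem_biUnion, Finset.mem_range, mem_gadget]
  constructor
  · rintro (⟨x, h, rfl, rfl⟩ | h)
    · exact Or.inl ⟨rfl, h⟩
    · exact Or.inr h
  · rintro (⟨rfl, h⟩ | h)
    · exact Or.inl ⟨a, h, rfl, rfl⟩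
    · exact Or.inr h

/-- The gadgets are placed from left to right without overlaps. -/
def Spaced (m : ℕ) (X : ℕ → ℤ) : Prop := ∀ i j, i < j → j < m → X i + 16 ≤ X j

theorem Spaced.eq_of_near {m : ℕ} {X : ℕ → ℤ} (h : Spaced m X) {i j : ℕ} (hi : i < m) (hj : j < m)
    (h1 : X i < X j + 16) (h2 : X j < X i + 16) : i = j := by
  rcases lt_trichotomy i j with hij | hij | hij
  · have := h i j hij hj
    omega
  · exact hij
  · have := h j i hij hi
    omega

theorem Spaced.le {m : ℕ} {X : ℕ → ℤ} (h : Spaced m X) {i j : ℕ} (hij : i ≤ j) (hj : j < m) :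
    X i ≤ X j := by
  rcases hij.lt_or_eq with hij | rfl
  · have := h i j hij hj
    omega
  · rfl

/-- Near gadget `i` and above the line, the comb looks like the gadget. -/
theorem mem_comb_local {m : ℕ} {X : ℕ → ℤ} {σ : ℕ → ℕ} (hX : Spaced m X) {i : ℕ} (hi : i < m)
    {x y : ℤ} (hx : 0 ≤ x ∧ x ≤ 15) (hy : 0 ≤ y) :
    (X i + x, 1 + y) ∈ comb m X σ ↔ occ (σ i) x y = true := by
  rw [mem_comb]
  constructor
  · rintro (⟨h, -⟩ | ⟨j, hj, h⟩)
    · omega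
    · have := occ_iff.1 h
      obtain rfl := hX.eq_of_near hi hj (by omega) (by omega)
      simpa using h
  · intro h
    exact Or.inr ⟨i, hi, by simpa using h⟩

theorem mem_comb_line {m : ℕ} {X : ℕ → ℤ} {σ : ℕ → ℕ} {a : ℤ} :
    (a, 0) ∈ comb m X σ ↔ X 0 + 13 ≤ a ∧ a ≤ X (m - 1) + 13 := by
  rw [mem_comb]
  constructor
  · rintro (⟨-, h⟩ | ⟨j, hj, h⟩)
    · exact h
    · have := occ_iff.1 h
      omega
  · exact fun h => Or.inl ⟨rfl, h⟩

theorem nonneg_of_mem_comb {m : ℕ} {X : ℕ → ℤ} {σ : ℕ → ℕ} {a b : ℤ} (h : (a, b) ∈ comb m X σ) :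
    0 ≤ b := by
  rcases mem_comb.1 h with ⟨rfl, -⟩ | ⟨i, -, h⟩
  · rfl
  · have := occ_iff.1 h
    omega

theorem Spaced.foot_mem {m : ℕ} {X : ℕ → ℤ} (hX : Spaced m X) {σ : ℕ → ℕ} {i : ℕ} (hi : i < m) :
    (X i + 13, 0) ∈ comb m X σ := by
  rw [mem_comb_line]
  have h1 := hX.le (Nat.zero_le i) hi
  have h2 := hX.le (i := i) (j := m - 1) (by omega) (by omega)
  omega

/-- The two lowest rows above the line consist of the stems. -/
theorem mem_comb_stem {m : ℕ} {X : ℕ → ℤ} {σ : ℕ → ℕ} (hσ : ∀ i < m, stemOK (σ i) = true)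
    {a b : ℤ} (hb : b = 1 ∨ b = 2) : (a, b) ∈ comb m X σ ↔ ∃ i < m, a = X i + 13 := by
  rw [mem_comb]
  constructor
  · rintro (⟨h, -⟩ | ⟨i, hi, h⟩)
    · omega
    · refine ⟨i, hi, ?_⟩
      have hs := stem_iff (hσ i hi) (a - X i)
      rcases hb with rfl | rfl
      · have := hs.1.1 (by simpa using h)
        omega
      · have := hs.2.1.1 (by simpa using h)
        omega
  · rintro ⟨i, hi, rfl⟩
    refine Or.inr ⟨i, hi, ?_⟩
    have hs := stem_iff (hσ i hi) 13
    rcases hb with rfl | rfl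
    · simpa using hs.1
    · simpa using hs.2.1

/-- Moving a module inside a gadget changes the state of that gadget. -/
theorem comb_update {m : ℕ} {X : ℕ → ℤ} {σ : ℕ → ℕ} (hX : Spaced m X) {i : ℕ} (hi : i < m)
    {x y x' y' : ℤ} (h : occ (σ i) x y = true) (h' : occ (σ i) x' y' = false)
    (hx' : 2 ≤ x' ∧ x' ≤ 13) (hy' : 0 ≤ y' ∧ y' ≤ 13) :
    insert (X i + x', 1 + y') ((comb m X σ).erase (X i + x, 1 + y)) =
      comb m X (Function.update σ i (shift (σ i) x y x' y')) := by
  have h0 := occ_iff.1 h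
  ext ⟨a, b⟩
  rw [Finset.mem_insert, Finset.mem_erase, mem_comb, mem_comb]
  simp only [ne_eq, Prod.mk.injEq]
  constructor
  · rintro (⟨rfl, rfl⟩ | ⟨hne, hl | ⟨j, hj, hocc⟩⟩)
    · refine Or.inr ⟨i, hi, ?_⟩
      rw [Function.update_self, occ_shift h h' hx' hy']
      left; constructor <;> ring
    · exact Or.inl hl
    · refine Or.inr ⟨j, hj, ?_⟩
      by_cases hij : j = i
      · subst hij
        rw [Function.update_self, occ_shift h h' hx' hy']
        refine Or.inr ⟨hocc, fun hh => hne ?_⟩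
        omega
      · rwa [Function.update_of_ne hij]
  · rintro (hl | ⟨j, hj, hocc⟩)
    · refine Or.inr ⟨?_, Or.inl hl⟩
      rintro ⟨-, hb⟩
      omega
    · by_cases hij : j = i
      · subst hij
        rw [Function.update_self, occ_shift h h' hx' hy'] at hocc
        rcases hocc with ⟨h1, h2⟩ | ⟨h1, h2⟩
        · left; constructor <;> omega
        · refine Or.inr ⟨fun hh => h2 ?_, Or.inr ⟨j, hj, h1⟩⟩
          constructor <;> omega
      · rw [Function.update_of_ne hij] at hocc
        have := occ_iff.1 hocc
        refine Or.inr ⟨fun hh => hij ?_, Or.inr ⟨j, hj, hocc⟩⟩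
        exact hX.eq_of_near hj hi (by omega) (by omega)

/-- A gadget is attached to the rest of the comb at the foot of its stem only. -/
theorem gadget_closed {m : ℕ} {X : ℕ → ℤ} {σ : ℕ → ℕ} (hX : Spaced m X)
    (hσ : ∀ i < m, stemOK (σ i) = true) {i : ℕ} (hi : i < m) {x y : ℤ}
    (h : occ (σ i) x y = true) {q : Cell} (hq : q ∈ comb m X σ) (hne : q ≠ (X i + 13, 0))
    (hd : IsDir (q - (X i + x, 1 + y))) : ∃ x' y', q = (X i + x', 1 + y') ∧
      occ (σ i) x' y' = true ∧ IsDir (x' - x, y' - y) := by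
  obtain ⟨a, b⟩ := q
  have h0 := occ_iff.1 h
  have hd' : IsDir (a - X i - x, b - 1 - y) := by
    convert hd using 1
    ext <;> simp <;> ring
  refine ⟨a - X i, b - 1, by ext <;> simp, ?_, hd'⟩
  have hb := nonneg_of_mem_comb hq
  simp only [IsDir, Prod.mk.injEq] at hd'
  rw [← mem_comb_local hX hi (by omega) ?_]
  · convert hq using 2 <;> ring
  -- A neighbour on the line could only lie below a module of row 0, which is the stem, and is then
  -- the excluded foot.
  · by_contra hneg
    have hy : y = 0 := by omega
    subst hy
    have := (stem_iff (hσ i hi) x).1.1 h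
    apply hne
    ext
    · simp; omega
    · simp; omega

/-! ### Moves of a comb stay inside its gadgets -/

/-- The local check of a frame controls every move of the module with that frame. -/
theorem okFrame_sound {C D : Finset Cell} {P x y : ℤ} {M : ℕ}
    (hloc : ∀ u v : ℤ, 0 ≤ u ∧ u ≤ 15 → 0 ≤ v → ((P + u, 1 + v) ∈ C ↔ occ M u v = true))
    (hx : 2 ≤ x ∧ x ≤ 13) (hy : 2 ≤ y) {d e : Cell} (hf : IsFrame d e)
    (hok : okFrame M x y d.1 d.2 e.1 e.2 = true) {a : Cell} (ha : a = (P + x, 1 + y))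
    (hs : a + d ∈ C) (hae : a + e ∉ C) (had : a - d ∉ C) (haed : a + e - d ∉ C)
    (h : (a + d + e ∈ C ∧ D = insert (a + e) (C.erase a)) ∨
      (a + d + e ∉ C ∧ a + e + e ∉ C ∧ a + d + e + e ∉ C ∧
        D = insert (a + d + e) (C.erase a))) :
    ∃ x' y', okTarget M x y x' y' = true ∧ occ M x' y' = false ∧
      D = insert (P + x', 1 + y') (C.erase a) := by
  obtain ⟨d₁, d₂⟩ := d
  obtain ⟨e₁, e₂⟩ := e
  have hb : (d₁ = 0 ∧ e₂ = 0 ∧ (d₂ = 1 ∨ d₂ = -1) ∧ (e₁ = 1 ∨ e₁ = -1)) ∨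
      (d₂ = 0 ∧ e₁ = 0 ∧ (d₁ = 1 ∨ d₁ = -1) ∧ (e₂ = 1 ∨ e₂ = -1)) := by
    have := hf.cases
    simp only [Prod.mk.injEq] at this
    omega
  -- A pivot inspects cells at distance at most two in each coordinate. The bounds on `x` keep them
  -- in the window of columns 0 to 15, and `2 ≤ y` keeps them above the line.
  have tr : ∀ (p : Cell) (u v : ℤ), p = (P + u, 1 + v) → 0 ≤ u ∧ u ≤ 15 → 0 ≤ v →
      (p ∈ C ↔ occ M u v = true) := by
    rintro p u v rfl
    exact hloc u v
  have trf : ∀ (p : Cell) (u v : ℤ), p = (P + u, 1 + v) → 0 ≤ u ∧ u ≤ 15 → 0 ≤ v →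
      p ∉ C → occ M u v = false := by
    intro p u v hp hu hv hpC
    rw [tr p u v hp hu hv] at hpC
    simpa using hpC
  subst ha
  have f1 := (tr _ (x + d₁) (y + d₂) (by ext <;> simp <;> ring) (by omega) (by omega)).1 hs
  have f2 := trf _ (x + e₁) (y + e₂) (by ext <;> simp <;> ring) (by omega) (by omega) hae
  have f3 := trf _ (x - d₁) (y - d₂) (by ext <;> simp <;> ring) (by omega) (by omega) had
  have f4 := trf _ (x + e₁ - d₁) (y + e₂ - d₂) (by ext <;> simp <;> ring) (by omega) (by omega) haed
  simp only [okFrame, f1, f2, f3, f4, Bool.not_true, Bool.false_or] at hok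
  rcases h with ⟨h1, rfl⟩ | ⟨h1, h2, h3, rfl⟩
  · have f5 := (tr _ (x + d₁ + e₁) (y + d₂ + e₂) (by ext <;> simp <;> ring) (by omega)
      (by omega)).1 h1
    rw [f5, cond_true] at hok
    refine ⟨_, _, hok, f2, ?_⟩
    congr 1
    ext <;> simp <;> ring
  · have f5 := trf _ (x + d₁ + e₁) (y + d₂ + e₂) (by ext <;> simp <;> ring) (by omega)
      (by omega) h1
    have f6 := trf _ (x + e₁ + e₁) (y + e₂ + e₂) (by ext <;> simp <;> ring) (by omega)
      (by omega) h2
    have f7 := trf _ (x + d₁ + e₁ + e₁) (y + d₂ + e₂ + e₂) (by ext <;> simp <;> ring) (by omega)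
      (by omega) h3
    rw [f5, cond_false, f6, f7, Bool.false_or, Bool.false_or] at hok
    refine ⟨_, _, hok, f5, ?_⟩
    congr 1
    ext <;> simp <;> ring

/-- Removing the line module below a stem separates the gadget, if the line goes on. -/
theorem not_connected_erase_foot {m : ℕ} {X : ℕ → ℤ} {σ : ℕ → ℕ} (hm : 2 ≤ m) (hX : Spaced m X)
    (hσ : ∀ i < m, stemOK (σ i) = true) {i : ℕ} (hi : i < m) :
    ¬ FacetConnected ((comb m X σ).erase (X i + 13, 0)) := by
  intro hc
  obtain ⟨j, hj, hij⟩ : ∃ j < m, j ≠ i := by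
    by_cases h : i = 0
    · exact ⟨1, by omega, by omega⟩
    · exact ⟨0, by omega, by omega⟩
  have hne : X j + 13 ≠ X i + 13 := fun h => hij (hX.eq_of_near hj hi (by omega) (by omega))
  have h0 := (stem_iff (hσ i hi) 13).1.2 rfl
  have key := hc.subset_of_closed
    (S := {p | ∃ x y, p = (X i + x, 1 + y) ∧ occ (σ i) x y = true}) ?_ (p₀ := (X i + 13, 1 + 0)) ?_
    ⟨13, 0, rfl, h0⟩ (X j + 13, 0) ?_
  · obtain ⟨x, y, h1, h2⟩ := key
    have := occ_iff.1 h2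
    simp only [Prod.mk.injEq] at h1
    omega
  · rintro p - ⟨x, y, rfl, h⟩ q hq hd
    obtain ⟨x', y', h1, h2, -⟩ := gadget_closed hX hσ hi h (Finset.mem_of_mem_erase hq)
      (Finset.ne_of_mem_erase hq) hd
    exact ⟨x', y', h1, h2⟩
  · exact Finset.mem_erase.2 ⟨by simp, (mem_comb_local hX hi (by norm_num) le_rfl).2 h0⟩
  · exact Finset.mem_erase.2 ⟨by simpa using hne, hX.foot_mem hj⟩

/-- Removing a module that passes the cut test separates the comb. -/
theorem not_connected_erase_of_isCut {m : ℕ} {X : ℕ → ℤ} {σ : ℕ → ℕ} (hX : Spaced m X)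
    (hσ : ∀ i < m, stemOK (σ i) = true) {i : ℕ} (hi : i < m) {x y : ℤ}
    (hocc : occ (σ i) x y = true) (hcut : isCut (σ i) x y = true) :
    ¬ FacetConnected ((comb m X σ).erase (X i + x, 1 + y)) := by
  intro hc
  simp only [isCut, Bool.and_eq_true, Nat.beq_eq, List.any_eq_true] at hcut
  obtain ⟨⟨⟨⟨x₀, y₀⟩, -, h0⟩, hexp⟩, hrow⟩ := hcut
  -- Correctness of the flood fill is not needed. All that matters is that `F` is nonempty, is
  -- closed under adjacency in the gadget without `(x, y)`, and misses row 0.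
  generalize cutOff (σ i) x y = F at h0 hexp hrow
  have hxy := occ_iff.1 hocc
  have hFM : ∀ {u v}, occ F u v = true → occ (σ i) u v = true ∧ ¬(u = x ∧ v = y) ∧ 1 ≤ v := by
    intro u v h
    have h' := occ_iff.1 h
    have hv : 1 ≤ v := by
      by_contra hv
      obtain rfl : v = 0 := by omega
      have hb : (F &&& 0xFFFF).testBit (16 * 0 + u).toNat = true := by
        rw [Nat.testBit_and, h'.2.2.2.2, show (0xFFFF : ℕ) = 2 ^ 16 - 1 by norm_num,
          Nat.testBit_two_pow_sub_one]
        simp only [Bool.true_and, decide_eq_true_eq]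
        omega
      rw [hrow] at hb
      simp at hb
    have hb := h'.2.2.2.2
    rw [← hexp, Nat.testBit_and, Nat.testBit_xor, testBit_cellMask ⟨hxy.1, hxy.2.1⟩ hxy.2.2.1
      ⟨h'.1, h'.2.1⟩ h'.2.2.1, Bool.and_eq_true] at hb
    have hb2 := hb.2
    by_cases hc : u = x ∧ v = y
    · rw [decide_eq_true hc] at hb2
      have : (σ i).testBit (16 * v + u).toNat = true := by
        rw [hc.1, hc.2]
        exact hxy.2.2.2.2
      rw [this] at hb2
      simp at hb2
    · rw [decide_eq_false hc, Bool.xor_false] at hb2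
      exact ⟨occ_iff.2 ⟨h'.1, h'.2.1, h'.2.2.1, h'.2.2.2.1, hb2⟩, hc, hv⟩
  have key := hc.subset_of_closed
    (S := {p | ∃ u v, p = (X i + u, 1 + v) ∧ occ F u v = true}) ?_ (p₀ := (X i + x₀, 1 + y₀)) ?_
    ⟨x₀, y₀, rfl, h0⟩ (X i + 13, 0) ?_
  · obtain ⟨u, v, h1, h2⟩ := key
    have := occ_iff.1 h2
    simp only [Prod.mk.injEq] at h1
    omega
  · rintro p - ⟨u, v, rfl, h⟩ q hq hd
    obtain ⟨hq1, hq2⟩ := Finset.mem_erase.1 hq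
    have hF := hFM h
    have h' := occ_iff.1 h
    -- The foot is excluded as a neighbour because `F` starts at row 1, that is, at height 2 above
    -- the line.
    obtain ⟨u', v', rfl, h2, hd'⟩ := gadget_closed hX hσ hi hF.1 hq2 (by
      rintro rfl
      simp only [IsDir, Prod.mk.injEq, Prod.mk_sub_mk] at hd
      omega) hd
    refine ⟨u', v', rfl, ?_⟩
    have h2' := occ_iff.1 h2
    refine occ_iff.2 ⟨h2'.1, h2'.2.1, h2'.2.2.1, h2'.2.2.2.1, ?_⟩
    rw [← hexp, Nat.testBit_and, Nat.testBit_xor, testBit_cellMask ⟨hxy.1, hxy.2.1⟩ hxy.2.2.1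
      ⟨h2'.1, h2'.2.1⟩ h2'.2.2.1, h2'.2.2.2.2, decide_eq_false, Bool.and_eq_true]
    · refine ⟨testBit_expand.2 ?_, rfl⟩
      simp only [IsDir, Prod.mk.injEq] at hd'
      have hb := h'.2.2.2.2
      rcases hd' with hd' | hd' | hd' | hd'
      · right; left
        refine ⟨by omega, ?_⟩
        convert hb using 2
        omega
      · right; right; left
        convert hb using 2
        omega
      · right; right; right; left
        refine ⟨by omega, ?_⟩
        convert hb using 2
        omega
      · right; right; right; right
        convert hb using 2
        omega
    · rintro ⟨rfl, rfl⟩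
      exact hq1 rfl
  · have hF := hFM h0
    have h' := occ_iff.1 h0
    refine Finset.mem_erase.2 ⟨?_, (mem_comb_local hX hi (by omega) (by omega)).2 hF.1⟩
    simp only [ne_eq, Prod.mk.injEq]
    omega
  · refine Finset.mem_erase.2 ⟨?_, hX.foot_mem hi⟩
    simp only [ne_eq, Prod.mk.injEq]
    omega

theorem okFrame_of_okCell {M : ℕ} {x y : ℤ} (h : okCell M x y = true)
    (hcut : ¬ isCut M x y = true) {d e : Cell} (hf : IsFrame d e) :
    okFrame M x y d.1 d.2 e.1 e.2 = true := by
  simp only [okCell, Bool.or_eq_true, Bool.and_eq_true, hcut, Bool.false_eq_true, or_false] at h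
  rcases hf.cases with ⟨rfl | rfl, rfl | rfl⟩ | ⟨rfl | rfl, rfl | rfl⟩ <;> simp only [h]

/-- Combs whose gadgets are in reachable states only move to combs of the same kind. -/
theorem comb_move {m : ℕ} {X : ℕ → ℤ} {σ : ℕ → ℕ} (hm : 2 ≤ m) (hX : Spaced m X)
    (hσ : ∀ i < m, σ i ∈ states) {D : Finset Cell} (h : RestrictiveMove (comb m X σ) D) :
    ∃ i < m, ∃ M ∈ states, D = comb m X (Function.update σ i M) := by
  have hstem : ∀ i < m, stemOK (σ i) = true := fun i hi => stemOK_of_mem (hσ i hi)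
  obtain ⟨⟨a, b⟩, d, e, hf, ha, hs, hc, hae, had, haed, h⟩ := h
  rcases mem_comb.1 ha with ⟨rfl, h1, h2⟩ | ⟨i, hi, hocc⟩
  · exfalso
    -- Both ends of the line are feet of gadgets, hence cut vertices; every other module of the line
    -- lies between two others.
    by_cases hl : a = X 0 + 13
    · subst hl
      exact not_connected_erase_foot hm hX hstem (by omega) hc
    by_cases hr : a = X (m - 1) + 13
    · subst hr
      exact not_connected_erase_foot hm hX hstem (by omega) hc
    refine no_move_of_opposite_neighbours hf (u := (1, 0)) (Or.inl rfl) ?_ ?_ hae had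
    · have : (a + 1, 0) ∈ comb m X σ := mem_comb_line.2 (by omega)
      simpa using this
    · have : (a - 1, 0) ∈ comb m X σ := mem_comb_line.2 (by omega)
      simpa using this
  · have hab := occ_iff.1 hocc
    obtain ⟨x, rfl⟩ : ∃ x, a = X i + x := ⟨a - X i, by ring⟩
    obtain ⟨y, rfl⟩ : ∃ y, b = 1 + y := ⟨b - 1, by ring⟩
    simp only [add_sub_cancel_left] at hocc hab
    -- The two lowest stem modules lie too close to the line for the local check. They have modules
    -- directly above and below.
    by_cases hy : y < 2
    · exfalso
      have hst := stem_iff (hstem i hi) x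
      have h3 : ∀ y', y' = 0 ∨ y' = 1 ∨ y' = 2 ∨ y' = 3 → (X i + 13, y') ∈ comb m X σ := by
        have h13 := stem_iff (hstem i hi) 13
        rintro y' (rfl | rfl | rfl | rfl)
        · exact hX.foot_mem hi
        · exact (mem_comb_local hX hi (y := 0) (by norm_num) (by norm_num)).2 (h13.1.2 rfl)
        · exact (mem_comb_local hX hi (y := 1) (by norm_num) (by norm_num)).2 (h13.2.1.2 rfl)
        · exact (mem_comb_local hX hi (y := 2) (by norm_num) (by norm_num)).2 h13.2.2
      have hx13 : x = 13 := by
        obtain rfl | rfl : y = 0 ∨ y = 1 := by omega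
        · exact hst.1.1 hocc
        · exact hst.2.1.1 hocc
      subst hx13
      refine no_move_of_opposite_neighbours hf (u := (0, 1)) (Or.inr (Or.inr (Or.inl rfl))) ?_ ?_ hae had
      · simpa using h3 (1 + y + 1) (by omega)
      · simpa using h3 y (by omega)
    · have hcut : ¬ isCut (σ i) x y = true := fun hcut =>
        not_connected_erase_of_isCut hX hstem hi hocc hcut hc
      have hcell := List.all_eq_true.1 (states_stateOK _ (hσ i hi)) (x, y)
        (mem_boxList ⟨hab.1, hab.2.1⟩ ⟨hab.2.2.1, hab.2.2.2.1⟩)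
      simp only [hocc, Bool.not_true, Bool.false_or, decide_eq_false hy] at hcell
      obtain ⟨x', y', ht, hfree, rfl⟩ := okFrame_sound
        (fun u v hu hv => mem_comb_local (σ := σ) hX hi hu hv) ⟨hab.1, hab.2.1⟩ (by omega) hf
        (okFrame_of_okCell hcell hcut hf) rfl hs hae had haed h
      simp only [okTarget, Bool.and_eq_true, decide_eq_true_eq, List.any_eq_true, Nat.beq_eq] at ht
      obtain ⟨⟨⟨⟨hx1, hx2⟩, hy1⟩, hy2⟩, M, hM, hMe⟩ := ht
      refine ⟨i, hi, M, hM, ?_⟩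
      rw [← hMe]
      exact comb_update hX hi hocc hfree ⟨hx1, hx2⟩ ⟨hy1, hy2⟩

/-! ### Connectivity of combs -/

theorem boxMask_testBit {n : ℕ} (h : boxMask.testBit n = true) :
    n < 224 ∧ 2 ≤ n % 16 ∧ n % 16 ≤ 13 := by
  have hn : n < 224 := by
    by_contra hn
    rw [Nat.testBit_lt_two_pow (lt_of_lt_of_le (b := 2 ^ 224) (by decide)
      (Nat.pow_le_pow_right (by norm_num) (not_lt.1 hn)))] at h
    exact absurd h (by decide)
  have key : ∀ n < 224, boxMask.testBit n = true → 2 ≤ n % 16 ∧ n % 16 ≤ 13 := by decide +kernel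
  exact ⟨hn, key n hn h⟩

/-- Flood filling only reaches cells that are connected to the start. -/
theorem reach_of_flood {C : Finset Cell} {r : Cell} {P : ℤ} {M : ℕ}
    (hM : ∀ n, M.testBit n = true →
      n < 224 ∧ 2 ≤ n % 16 ∧ n % 16 ≤ 13 ∧ (P + (n % 16 : ℕ), 1 + ((n / 16 : ℕ) : ℤ)) ∈ C)
    (k F : ℕ) (hF : ∀ n, F.testBit n = true → M.testBit n = true ∧
      Relation.ReflTransGen (Step C) r (P + (n % 16 : ℕ), 1 + ((n / 16 : ℕ) : ℤ))) :
    ∀ n, (flood M k F).testBit n = true →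
      Relation.ReflTransGen (Step C) r (P + (n % 16 : ℕ), 1 + ((n / 16 : ℕ) : ℤ)) := by
  induction k generalizing F with
  | zero => exact fun n hn => (hF n hn).2
  | succ k ih =>
    refine ih _ fun n hn => ?_
    rw [Nat.testBit_and, Bool.and_eq_true] at hn
    obtain ⟨hn, hnM⟩ := hn
    refine ⟨hnM, ?_⟩
    have hn' := hM n hnM
    have step : ∀ n', F.testBit n' = true → (n' = n + 1 ∨ n = n' + 1 ∨ n' = n + 16 ∨ n = n' + 16) →
        Relation.ReflTransGen (Step C) r (P + (n % 16 : ℕ), 1 + ((n / 16 : ℕ) : ℤ)) := by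
      intro n' hF' hnn
      obtain ⟨h1, h2⟩ := hF n' hF'
      have h3 := hM n' h1
      refine h2.tail ⟨hn'.2.2.2, ?_⟩
      -- Both indices have residue between 2 and 13 modulo 16, so a difference of 1 cannot wrap
      -- around to another row.
      simp only [IsDir, Prod.mk_sub_mk, Prod.mk.injEq]
      omega
    rcases testBit_expand.1 hn with h | ⟨h0, h⟩ | h | ⟨h0, h⟩ | h
    · exact (hF n h).2
    · exact step _ h (by omega)
    · exact step _ h (by omega)
    · exact step _ h (by omega)
    · exact step _ h (by omega)

theorem stemOK_of_footConnected {M : ℕ} (h : footConnected M = true) : stemOK M = true := by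
  simp only [footConnected, Bool.and_eq_true] at h
  exact h.2

theorem comb_connected {m : ℕ} {X : ℕ → ℤ} {σ : ℕ → ℕ} (hm : 1 ≤ m) (hX : Spaced m X)
    (hσ : ∀ i < m, footConnected (σ i) = true) : FacetConnected (comb m X σ) := by
  have hle := hX.le (i := 0) (j := m - 1) (by omega) (by omega)
  have hline : ∀ k : ℕ, X 0 + 13 + k ≤ X (m - 1) + 13 →
      Relation.ReflTransGen (Step (comb m X σ)) (X 0 + 13, 0) (X 0 + 13 + k, 0) := by
    intro k
    induction k with
    | zero => intro _; simpa using Relation.ReflTransGen.refl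
    | succ k ih =>
      intro hk
      push_cast at hk
      refine (ih (by omega)).tail ⟨mem_comb_line.2 (by push_cast; omega), ?_⟩
      left
      rw [Prod.mk_sub_mk, Prod.mk.injEq]
      push_cast
      exact ⟨by ring, trivial⟩
  have hline' : ∀ a, X 0 + 13 ≤ a → a ≤ X (m - 1) + 13 →
      Relation.ReflTransGen (Step (comb m X σ)) (X 0 + 13, 0) (a, 0) := by
    intro a h1 h2
    have h3 : X 0 + 13 + ((a - (X 0 + 13)).toNat : ℤ) = a := by omega
    have := hline (a - (X 0 + 13)).toNat (by omega)
    rwa [h3] at this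
  refine facetConnected_of_reach (r := (X 0 + 13, 0)) (hX.foot_mem (by omega)) ?_
  rintro ⟨a, b⟩ hab
  rcases mem_comb.1 hab with ⟨rfl, h1, h2⟩ | ⟨i, hi, hocc⟩
  · exact hline' a h1 h2
  · have hst := stem_iff (stemOK_of_footConnected (hσ i hi)) 13
    have hfc := hσ i hi
    simp only [footConnected, Bool.and_eq_true, Nat.beq_eq] at hfc
    obtain ⟨⟨hfl, hbox⟩, -⟩ := hfc
    have hM : ∀ n, (σ i).testBit n = true → n < 224 ∧ 2 ≤ n % 16 ∧ n % 16 ≤ 13 ∧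
        (X i + (n % 16 : ℕ), 1 + ((n / 16 : ℕ) : ℤ)) ∈ comb m X σ := by
      intro n hn
      have hn' := hn
      rw [← hbox, Nat.testBit_and, Bool.and_eq_true] at hn'
      have hb := boxMask_testBit hn'.2
      refine ⟨hb.1, hb.2.1, hb.2.2, ?_⟩
      rw [mem_comb_local hX hi (by omega) (by omega), occ_iff]
      refine ⟨by omega, by omega, by omega, by omega, ?_⟩
      convert hn using 2
      omega
    have hfoot : Relation.ReflTransGen (Step (comb m X σ)) (X 0 + 13, 0) (X i + 13, 1) := by
      have h0 := mem_comb_line.1 (hX.foot_mem (σ := σ) hi)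
      refine (hline' (X i + 13) h0.1 h0.2).tail ⟨?_, ?_⟩
      · exact (mem_comb_local hX hi (y := 0) (by norm_num) (by norm_num)).2 (hst.1.2 rfl)
      · simp [IsDir]
    -- A state used here has at most 46 modules, so 48 rounds of flooding suffice.
    have key := reach_of_flood (r := (X 0 + 13, 0)) hM 48 (cellMask 13 0) ?_
    · have h0 := occ_iff.1 hocc
      have := key (16 * (b - 1) + (a - X i)).toNat (by rw [hfl]; exact h0.2.2.2.2)
      convert this using 2
      · omega
      · omega
    · intro n hn
      rw [cellMask, Nat.testBit_two_pow, decide_eq_true_eq] at hn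
      subst hn
      exact ⟨(occ_iff.1 (hst.1.2 rfl)).2.2.2.2, by simpa using hfoot⟩

/-! ### Absence of patterns Γ and I -/

theorem noGammaI_spec {M : ℕ} (h : noGammaI M = true) {x y : ℤ} (hxy : occ M x y = true) {d : ℤ}
    (hd : d = 1 ∨ d = -1) :
    (occ M (x + d + d) y = true → occ M (x + d) y = true) ∧
    (occ M x (y + d + d) = true → occ M x (y + d) = true) ∧
    ∀ e : ℤ, e = 1 ∨ e = -1 → occ M (x + d) (y + e) = true →
      occ M (x + d) y = true ∨ occ M x (y + e) = true := by
  have h0 := occ_iff.1 hxy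
  have h1 := List.all_eq_true.1 h (x, y) (mem_boxList ⟨h0.1, h0.2.1⟩ ⟨h0.2.2.1, h0.2.2.2.1⟩)
  simp only [hxy, Bool.not_true, Bool.false_or] at h1
  have h2 := List.all_eq_true.1 h1 d (by simpa using hd)
  simp only [Bool.and_eq_true] at h2
  refine ⟨fun hh => ?_, fun hh => ?_, fun e he hh => ?_⟩
  · simpa [hh] using h2.1.1
  · simpa [hh] using h2.1.2
  · simpa [hh] using List.all_eq_true.1 h2.2 e (by simpa using he)

/-- The mask check covers occurrences above the line. An occurrence touching the line is impossible:
the line has no gaps, and a module at height 2 belongs to a stem that also occupies height 1. -/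
theorem comb_not_hasI {m : ℕ} {X : ℕ → ℤ} {σ : ℕ → ℕ} (hX : Spaced m X)
    (hst : ∀ i < m, stemOK (σ i) = true) (hσ : ∀ i < m, noGammaI (σ i) = true) :
    ¬ HasI (comb m X σ) := by
  rintro ⟨⟨a, b⟩, ⟨d₁, d₂⟩, hd, h1, h2, h3⟩
  simp only [Prod.mk_add_mk] at h2 h3
  simp only [IsDir, Prod.mk.injEq] at hd
  have hb := nonneg_of_mem_comb h1
  have hb3 := nonneg_of_mem_comb h3
  by_cases hrow : b = 0 ∨ b + d₂ + d₂ = 0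
  · by_cases hd2 : d₂ = 0
    · subst hd2
      obtain rfl : b = 0 := by omega
      apply h2
      simp only [add_zero] at h1 h3 ⊢
      rw [mem_comb_line] at h1 h3 ⊢
      omega
    · have key : ∀ c, (c, (2 : ℤ)) ∈ comb m X σ → (c, (1 : ℤ)) ∈ comb m X σ := fun c hc =>
        (mem_comb_stem hst (Or.inl rfl)).2 ((mem_comb_stem hst (Or.inr rfl)).1 hc)
      apply h2
      obtain rfl : d₁ = 0 := by omega
      simp only [add_zero] at h3 ⊢
      rcases hrow with rfl | hrow
      · obtain rfl : d₂ = 1 := by omega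
        exact key a h3
      · obtain rfl : b = 2 := by omega
        obtain rfl : d₂ = -1 := by omega
        exact key a h1
  · obtain ⟨i, hi, hocc⟩ := (mem_comb.1 h1).resolve_left (by omega)
    have h0 := occ_iff.1 hocc
    have hloc : ∀ u v : ℤ, 0 ≤ u ∧ u ≤ 15 → 0 ≤ v → ∀ p : Cell, p = (X i + u, 1 + v) →
        (p ∈ comb m X σ ↔ occ (σ i) u v = true) := by
      rintro u v hu hv p rfl
      exact mem_comb_local hX hi hu hv
    have h3' := (hloc (a - X i + d₁ + d₁) (b - 1 + d₂ + d₂) (by omega) (by omega) _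
      (by ext <;> simp <;> ring)).1 h3
    refine h2 ((hloc (a - X i + d₁) (b - 1 + d₂) (by omega) (by omega) _
      (by ext <;> simp <;> ring)).2 ?_)
    have spec := fun d hd => noGammaI_spec (hσ i hi) hocc (d := d) hd
    rcases hd with ⟨rfl, rfl⟩ | ⟨rfl, rfl⟩ | ⟨rfl, rfl⟩ | ⟨rfl, rfl⟩
    · simpa using (spec 1 (Or.inl rfl)).1 (by simpa using h3')
    · simpa using (spec (-1) (Or.inr rfl)).1 (by simpa using h3')
    · simpa using (spec 1 (Or.inl rfl)).2.1 (by simpa using h3')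
    · simpa using (spec (-1) (Or.inr rfl)).2.1 (by simpa using h3')

/-- Above the line the mask check applies. At the line, any module at height 1 stands on a foot, so
one of the two common neighbours is occupied. -/
theorem comb_not_hasGamma {m : ℕ} {X : ℕ → ℤ} {σ : ℕ → ℕ} (hX : Spaced m X)
    (hst : ∀ i < m, stemOK (σ i) = true) (hσ : ∀ i < m, noGammaI (σ i) = true) :
    ¬ HasGamma (comb m X σ) := by
  suffices H : ∀ a b d e : ℤ, (d = 1 ∨ d = -1) → (e = 1 ∨ e = -1) → (a, b) ∈ comb m X σ →
      (a + d, b) ∉ comb m X σ → (a, b + e) ∉ comb m X σ → (a + d, b + e) ∉ comb m X σ by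
    rintro ⟨⟨a, b⟩, d, e, hf, h1, h2, h3, h4⟩
    rcases hf.cases with ⟨hd, he⟩ | ⟨hd, he⟩
    · refine H a b d.1 e.2 ?_ ?_ h1 ?_ ?_ ?_ <;>
        rcases hd with rfl | rfl <;> rcases he with rfl | rfl <;> simp_all
    · refine H a b e.1 d.2 ?_ ?_ h1 ?_ ?_ ?_ <;>
        rcases hd with rfl | rfl <;> rcases he with rfl | rfl <;> simp_all
  intro a b d e hd he h1 h2 h3 h4
  have hb := nonneg_of_mem_comb h1
  have hb4 := nonneg_of_mem_comb h4
  have hcol : ∀ c, (c, (1 : ℤ)) ∈ comb m X σ → (c, (0 : ℤ)) ∈ comb m X σ := by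
    intro c hc
    obtain ⟨i, hi, rfl⟩ := (mem_comb_stem hst (Or.inl rfl)).1 hc
    exact hX.foot_mem hi
  by_cases hrow : b = 0
  · subst hrow
    obtain rfl : e = 1 := by omega
    exact h2 (hcol _ h4)
  by_cases hrow' : b + e = 0
  · obtain rfl : b = 1 := by omega
    rw [hrow'] at h3
    exact h3 (hcol _ h1)
  obtain ⟨i, hi, hocc⟩ := (mem_comb.1 h1).resolve_left (by omega)
  have h0 := occ_iff.1 hocc
  have hloc : ∀ u v : ℤ, 0 ≤ u ∧ u ≤ 15 → 0 ≤ v → ∀ p : Cell, p = (X i + u, 1 + v) →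
      (p ∈ comb m X σ ↔ occ (σ i) u v = true) := by
    rintro u v hu hv p rfl
    exact mem_comb_local hX hi hu hv
  have := (noGammaI_spec (hσ i hi) hocc hd).2.2 e he
    ((hloc _ _ (by omega) (by omega) _ (by ext <;> simp <;> ring)).1 h4)
  rcases this with h | h
  · exact h2 ((hloc _ _ (by omega) (by omega) _ (by ext <;> simp; ring)).2 h)
  · exact h3 ((hloc _ _ (by omega) (by omega) _ (by ext <;> simp; ring)).2 h)

/-! ### The switch between the two states, and pattern Z -/

theorem occ_remove {M : ℕ} {x y u v : ℤ} (h : occ M x y = true) :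
    occ (M ^^^ cellMask x y) u v = true ↔ occ M u v = true ∧ ¬(u = x ∧ v = y) := by
  have h0 := occ_iff.1 h
  by_cases hc : u = x ∧ v = y
  · obtain ⟨rfl, rfl⟩ := hc
    rw [occ_iff, Nat.testBit_xor, testBit_cellMask ⟨h0.1, h0.2.1⟩ h0.2.2.1 ⟨h0.1, h0.2.1⟩ h0.2.2.1]
    simp [h0.2.2.2.2]
  · simp only [hc, not_false_eq_true, and_true]
    rw [occ_iff, occ_iff]
    refine and_congr_right fun h1 => and_congr_right fun h2 => and_congr_right fun h3 =>
      and_congr_right fun _ => ?_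
    rw [Nat.testBit_xor, testBit_cellMask ⟨h0.1, h0.2.1⟩ h0.2.2.1 ⟨h1, h2⟩ h3, decide_eq_false hc,
      Bool.xor_false]

theorem comb_erase {m : ℕ} {X : ℕ → ℤ} {σ : ℕ → ℕ} (hX : Spaced m X) {i : ℕ} (hi : i < m)
    {x y : ℤ} (h : occ (σ i) x y = true) :
    (comb m X σ).erase (X i + x, 1 + y) =
      comb m X (Function.update σ i (σ i ^^^ cellMask x y)) := by
  have h0 := occ_iff.1 h
  ext ⟨a, b⟩
  rw [Finset.mem_erase, mem_comb, mem_comb]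
  simp only [ne_eq, Prod.mk.injEq]
  constructor
  · rintro ⟨hne, hl | ⟨j, hj, hocc⟩⟩
    · exact Or.inl hl
    · refine Or.inr ⟨j, hj, ?_⟩
      by_cases hij : j = i
      · subst hij
        rw [Function.update_self, occ_remove h]
        exact ⟨hocc, fun hh => hne (by omega)⟩
      · rwa [Function.update_of_ne hij]
  · rintro (hl | ⟨j, hj, hocc⟩)
    · exact ⟨fun hh => by omega, Or.inl hl⟩
    · by_cases hij : j = i
      · subst hij
        rw [Function.update_self, occ_remove h] at hocc
        exact ⟨fun hh => hocc.2 (by omega), Or.inr ⟨j, hj, hocc.1⟩⟩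
      · rw [Function.update_of_ne hij] at hocc
        have := occ_iff.1 hocc
        exact ⟨fun hh => hij (hX.eq_of_near hj hi (by omega) (by omega)), Or.inr ⟨j, hj, hocc⟩⟩

theorem footConnected_stateA : footConnected stateA = true := by
  have := footConnected_states
  simp only [Bool.and_eq_true] at this
  exact this.1.1

theorem footConnected_stateB : footConnected stateB = true := by
  have := footConnected_states
  simp only [Bool.and_eq_true] at this
  exact this.1.2

theorem footConnected_stateAB : footConnected stateAB = true := by
  have := footConnected_states
  simp only [Bool.and_eq_true] at this
  exact this.2

/-- A gadget in state `stateA` may be switched to `stateB` by one move. -/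
theorem comb_switch {m : ℕ} {X : ℕ → ℤ} {σ : ℕ → ℕ} (hm : 1 ≤ m) (hX : Spaced m X)
    (hσ : ∀ i < m, footConnected (σ i) = true) {i : ℕ} (hi : i < m) (hA : σ i = stateA) :
    RestrictiveMove (comb m X σ) (comb m X (Function.update σ i stateB)) := by
  have hocc : occ (σ i) 5 7 = true := by rw [hA]; decide +kernel
  have hloc : ∀ u v : ℤ, 0 ≤ u ∧ u ≤ 15 → 0 ≤ v → ∀ p : Cell, p = (X i + u, 1 + v) →
      (p ∈ comb m X σ ↔ occ stateA u v = true) := by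
    rintro u v hu hv p rfl
    rw [mem_comb_local hX hi hu hv, hA]
  -- The tip `(5, 7)` turns by 180° about the upper vertex of its edge with `(6, 7)` and lands on
  -- `(6, 8)`.
  refine ⟨(X i + 5, 1 + 7), (1, 0), (0, 1), ⟨Or.inl rfl, Or.inr (Or.inr (Or.inl rfl)), by norm_num⟩,
    ?_, ?_, ?_, ?_, ?_, ?_, Or.inr ⟨?_, ?_, ?_, ?_⟩⟩
  · exact (mem_comb_local hX hi (by norm_num) (by norm_num)).2 hocc
  · rw [hloc 6 7 (by norm_num) (by norm_num) _ (by ext <;> simp; ring)]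
    decide +kernel
  · rw [comb_erase hX hi hocc]
    refine comb_connected hm hX fun j hj => ?_
    by_cases hij : j = i
    · subst hij
      rw [Function.update_self, hA, show stateA ^^^ cellMask 5 7 = stateAB by decide +kernel]
      exact footConnected_stateAB
    · rw [Function.update_of_ne hij]
      exact hσ j hj
  · rw [hloc 5 8 (by norm_num) (by norm_num) _ (by ext <;> simp)]
    decide +kernel
  · rw [hloc 4 7 (by norm_num) (by norm_num) _ (by ext <;> simp; ring)]
    decide +kernel
  · rw [hloc 4 8 (by norm_num) (by norm_num) _ (by ext <;> simp; ring)]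
    decide +kernel
  · rw [hloc 6 8 (by norm_num) (by norm_num) _ (by ext <;> simp; ring)]
    decide +kernel
  · rw [hloc 5 9 (by norm_num) (by norm_num) _ (by ext <;> simp)]
    decide +kernel
  · rw [hloc 6 9 (by norm_num) (by norm_num) _ (by ext <;> simp; ring)]
    decide +kernel
  · have := comb_update hX hi hocc (x' := 6) (y' := 8) (by rw [hA]; decide +kernel) (by norm_num)
      (by norm_num)
    rw [hA, show shift stateA 5 7 6 8 = stateB by decide +kernel] at this
    rw [← this]
    congr 1
    ext <;> simp
    ring

/-- Pattern Z occurs in every comb whose first gadget is in one of the states `stateA`, `stateB`. -/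
theorem comb_hasZ {m : ℕ} {X : ℕ → ℤ} {σ : ℕ → ℕ} (hm : 1 ≤ m) (hX : Spaced m X)
    (h0 : σ 0 = stateA ∨ σ 0 = stateB) : HasZ (comb m X σ) := by
  have hloc : ∀ u v : ℤ, 0 ≤ u ∧ u ≤ 15 → 0 ≤ v → ∀ p : Cell, p = (X 0 + u, 1 + v) →
      (p ∈ comb m X σ ↔ occ (σ 0) u v = true) := by
    rintro u v hu hv p rfl
    exact mem_comb_local hX (by omega) hu hv
  -- This Z lies inside the cavity, between `(7, 7)` and `(8, 9)`, and avoids both positions of the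
  -- switching module.
  refine ⟨(X 0 + 7, 1 + 7), (0, 1), (1, 0),
    ⟨Or.inr (Or.inr (Or.inl rfl)), Or.inl rfl, by norm_num⟩, ?_, ?_, ?_, ?_⟩
  · rw [hloc 7 7 (by norm_num) (by norm_num) _ rfl]
    rcases h0 with h | h <;> rw [h] <;> decide +kernel
  · rw [hloc 7 8 (by norm_num) (by norm_num) _ (by ext <;> simp)]
    rcases h0 with h | h <;> rw [h] <;> decide +kernel
  · rw [hloc 8 8 (by norm_num) (by norm_num) _ (by ext <;> simp; ring)]
    rcases h0 with h | h <;> rw [h] <;> decide +kernel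
  · rw [hloc 8 9 (by norm_num) (by norm_num) _ (by ext <;> simp; ring)]
    rcases h0 with h | h <;> rw [h] <;> decide +kernel

theorem comb_onlyZ {m : ℕ} {X : ℕ → ℤ} {σ : ℕ → ℕ} (hm : 1 ≤ m) (hX : Spaced m X)
    (hσ : ∀ i < m, σ i = stateA ∨ σ i = stateB) : OnlyZ (comb m X σ) := by
  have hn := noGammaI_states
  rw [Bool.and_eq_true] at hn
  have h1 : ∀ i < m, stemOK (σ i) = true := by
    intro i hi
    rcases hσ i hi with h | h <;> rw [h]
    · exact stemOK_of_footConnected footConnected_stateA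
    · exact stemOK_of_footConnected footConnected_stateB
  have h2 : ∀ i < m, noGammaI (σ i) = true := by
    intro i hi
    rcases hσ i hi with h | h <;> rw [h]
    · exact hn.1
    · exact hn.2
  exact ⟨comb_hasZ hm hX (hσ 0 (by omega)), comb_not_hasGamma hX h1 h2, comb_not_hasI hX h1 h2⟩

/-! ### Counting modules -/

/-- The number of marked cells. -/
def weight (M : ℕ) : ℕ := (boxList.filter fun p => occ M p.1 p.2).length

theorem boxList_toFinset :
    boxList.toFinset = Finset.Icc (2 : ℤ) 13 ×ˢ Finset.Icc (0 : ℤ) 13 := by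
  ext ⟨x, y⟩
  rw [List.mem_toFinset, Finset.mem_product, Finset.mem_Icc, Finset.mem_Icc]
  constructor
  · intro h
    simp only [boxList, List.mem_flatMap, List.mem_map, Prod.mk.injEq] at h
    obtain ⟨y, hy, x, hx, rfl, rfl⟩ := h
    simp only [List.mem_cons, List.not_mem_nil, or_false] at hx hy
    refine ⟨?_, ?_⟩ <;> dsimp only <;> omega
  · intro h
    exact mem_boxList h.1 h.2

theorem card_gadget (X : ℤ) (M : ℕ) : (gadget X M).card = weight M := by
  have hnd : boxList.Nodup := by decide +kernel
  rw [gadget, Finset.card_image_of_injective, ← boxList_toFinset, ← List.toFinset_filter,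
    List.toFinset_card_of_nodup (hnd.filter _), weight]
  rintro ⟨x, y⟩ ⟨x', y'⟩ h
  simpa using h

theorem weight_states : weight stateA = 46 ∧ weight stateB = 46 := by decide +kernel

theorem card_comb {m : ℕ} {X : ℕ → ℤ} {σ : ℕ → ℕ} (hX : Spaced m X)
    (hσ : ∀ i < m, σ i = stateA ∨ σ i = stateB) :
    (comb m X σ).card = (X (m - 1) + 1 - X 0).toNat + 46 * m := by
  rw [comb, Finset.card_union_of_disjoint, Finset.card_biUnion]
  · rw [baseLine, Finset.card_image_of_injective _ (fun a b h => (Prod.mk.injEq .. ▸ h).1),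
      Int.card_Icc]
    congr 1
    · congr 1
      ring
    · rw [Finset.sum_congr rfl (g := fun _ => 46)]
      · simp [mul_comm]
      · intro i hi
        rw [card_gadget]
        rcases hσ i (Finset.mem_range.1 hi) with h | h <;> rw [h]
        · exact weight_states.1
        · exact weight_states.2
  · intro i hi j hj hij
    rw [Function.onFun, Finset.disjoint_left]
    rintro ⟨a, b⟩ h1 h2
    rw [mem_gadget] at h1 h2
    have h1 := occ_iff.1 h1
    have h2 := occ_iff.1 h2
    exact hij (hX.eq_of_near (Finset.mem_range.1 hi) (Finset.mem_range.1 hj) (by omega) (by omega))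
  · rw [Finset.disjoint_left]
    rintro ⟨a, b⟩ h1 h2
    simp only [baseLine, Finset.mem_image, Finset.mem_Icc, Prod.mk.injEq] at h1
    simp only [Finset.mem_biUnion, mem_gadget] at h2
    obtain ⟨i, -, h2⟩ := h2
    have h2 := occ_iff.1 h2
    obtain ⟨x, -, -, h⟩ := h1
    omega

/-! ### Combs up to translation and their components -/

/-- Combs that are translates of each other are equal if their lines start at the same place. -/
theorem comb_rigid {m : ℕ} {X X' : ℕ → ℤ} {σ σ' : ℕ → ℕ} (hm : 1 ≤ m) (hX : Spaced m X)
    (hX' : Spaced m X') (h0 : X 0 = X' 0) {v : Cell}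
    (h : comb m X' σ' = translate v (comb m X σ)) : comb m X' σ' = comb m X σ := by
  obtain ⟨v₁, v₂⟩ := v
  have h1 : (X' 0 + 13 - v₁, 0 - v₂) ∈ comb m X σ := by
    have : ((X' 0 + 13, 0) : Cell) ∈ comb m X' σ' := hX'.foot_mem (by omega)
    rw [h, mem_translate] at this
    simpa using this
  have h2 : (X 0 + 13 + v₁, 0 + v₂) ∈ comb m X' σ' := by
    have : ((X 0 + 13, 0) : Cell) ∈ comb m X σ := hX.foot_mem (by omega)
    rw [h, mem_translate]
    simpa using this
  have h3 := nonneg_of_mem_comb h1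
  have h4 := nonneg_of_mem_comb h2
  -- Both combs have lowest row 0, and both lines start at the same cell, so neither coordinate of
  -- the translation can have a sign.
  obtain rfl : v₂ = 0 := by omega
  simp only [sub_zero, add_zero] at h1 h2
  rw [mem_comb_line] at h1 h2
  obtain rfl : v₁ = 0 := by omega
  rw [h]
  ext p
  rw [mem_translate, show ((0 : ℤ), (0 : ℤ)) = 0 from rfl, sub_zero]

/-- A comb is not a translate of a straight strip. -/
theorem translate_comb_not_isStrip {m : ℕ} {X : ℕ → ℤ} {σ : ℕ → ℕ} (hm : 2 ≤ m) (hX : Spaced m X)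
    (hst : ∀ i < m, stemOK (σ i) = true) (v : Cell) : ¬ IsStrip (translate v (comb m X σ)) := by
  rintro ⟨p, d, hd, h⟩
  have hmem : ∀ q ∈ comb m X σ, ∃ i : ℕ, q + v = p + (i : ℤ) • d := by
    intro q hq
    have := mem_translate_add (v := v).2 hq
    rw [h, Finset.mem_image] at this
    obtain ⟨i, -, hi⟩ := this
    exact ⟨i, hi.symm⟩
  have h01 := hX 0 1 (by norm_num) (by omega)
  have hle := hX.le (i := 1) (j := m - 1) (by omega) (by omega)
  -- The first foot, its right neighbour on the line and the stem module above it are not collinear.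
  obtain ⟨i, hi⟩ := hmem (X 0 + 13, 0) (hX.foot_mem (by omega))
  obtain ⟨j, hj⟩ := hmem (X 0 + 14, 0) (mem_comb_line.2 (by omega))
  obtain ⟨k, hk⟩ := hmem (X 0 + 13, 1)
    ((mem_comb_stem hst (Or.inl rfl)).2 ⟨0, by omega, rfl⟩)
  have e1 := congrArg Prod.fst hi
  have e2 := congrArg Prod.snd hi
  have e3 := congrArg Prod.fst hj
  have e4 := congrArg Prod.snd hj
  have e5 := congrArg Prod.fst hk
  have e6 := congrArg Prod.snd hk
  simp only [Prod.fst_add, Prod.snd_add, Prod.smul_fst, Prod.smul_snd, smul_eq_mul] at e1 e2 e3 e4 e5 e6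
  rcases hd with rfl | rfl | rfl | rfl <;> simp only [mul_zero, mul_one, mul_neg] at * <;> omega

theorem Config.shape_eq {n : ℕ} {C D : Config n} :
    C.shape = D.shape ↔ ∃ v, D.1 = translate v C.1 := Quotient.eq

theorem card_translate (v : Cell) (C : Finset Cell) : (translate v C).card = C.card :=
  Finset.card_image_of_injective _ (add_left_injective v)

/-- The shapes of combs with offsets `X` whose gadgets are in reachable states. -/
def combShapes (n m : ℕ) (X : ℕ → ℤ) : Set (Shape n) :=
  {S | ∃ C : Config n, C.shape = S ∧ ∃ σ : ℕ → ℕ, (∀ i < m, σ i ∈ states) ∧ C.1 = comb m X σ}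

theorem exists_move_of_adj {n : ℕ} {S T : Shape n} (h : (reconfGraph n).Adj S T) :
    ∃ C D : Config n, C.shape = S ∧ D.shape = T ∧ RestrictiveMove C.1 D.1 := by
  rw [reconfGraph, SimpleGraph.fromRel_adj] at h
  rcases h with ⟨-, h | ⟨C, D, hC, hD, h⟩⟩
  · exact h
  · exact ⟨D, C, hD, hC, h.symm⟩

/-- Adjacency provides some placed representative of the shape, not necessarily the comb.
Translating the move back onto the comb makes `comb_move` applicable. -/
theorem combShapes_of_adj {n m : ℕ} {X : ℕ → ℤ} (hm : 2 ≤ m) (hX : Spaced m X) {S T : Shape n}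
    (hS : S ∈ combShapes n m X) (h : (reconfGraph n).Adj S T) : T ∈ combShapes n m X := by
  obtain ⟨C₀, rfl, σ, hσ, hC₀⟩ := hS
  obtain ⟨C, D, hC, rfl, hmove⟩ := exists_move_of_adj h
  obtain ⟨v, hv⟩ := Config.shape_eq.1 hC
  have hmove' := hmove.translate v
  rw [← hv, hC₀] at hmove'
  obtain ⟨i, hi, M, hM, hD⟩ := comb_move hm hX hσ hmove'
  refine ⟨⟨translate v D.1, (card_translate v D.1).trans D.2.1, D.2.2.translate v⟩,
    (Config.shape_eq.2 ⟨v, rfl⟩).symm, _, fun j hj => ?_, hD⟩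
  by_cases hij : j = i
  · subst hij
    rwa [Function.update_self]
  · rw [Function.update_of_ne hij]
    exact hσ j hj

theorem combShapes_of_reachable {n m : ℕ} {X : ℕ → ℤ} (hm : 2 ≤ m) (hX : Spaced m X)
    {S T : Shape n} (hS : S ∈ combShapes n m X) (h : (reconfGraph n).Reachable S T) :
    T ∈ combShapes n m X := by
  obtain ⟨w⟩ := h
  induction w with
  | nil => exact hS
  | cons hadj _ ih => exact ih (combShapes_of_adj hm hX hS hadj)

theorem combShapes_not_strip {n m : ℕ} {X : ℕ → ℤ} (hm : 2 ≤ m) (hX : Spaced m X)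
    {S : Shape n} (hS : S ∈ combShapes n m X) : S ∉ stripShapes n := by
  rintro ⟨D, hD, hstrip⟩
  obtain ⟨C, rfl, σ, hσ, hC⟩ := hS
  obtain ⟨v, hv⟩ := Config.shape_eq.1 hD.symm
  rw [hv, hC] at hstrip
  exact translate_comb_not_isStrip hm hX (fun i hi => stemOK_of_mem (hσ i hi)) v hstrip

/-- Rigidity turns equal shapes into equal sets of cells. At height 1 a comb consists of its stems
only, whatever the states, so this row displays the offsets. -/
theorem exists_combShapes_inter {n m : ℕ} {X X' : ℕ → ℤ} (hm : 1 ≤ m) (hX : Spaced m X)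
    (hX' : Spaced m X') (h0 : X 0 = X' 0) {S : Shape n} (hS : S ∈ combShapes n m X)
    (hS' : S ∈ combShapes n m X') {i : ℕ} (hi : i < m) : ∃ j < m, X i = X' j := by
  obtain ⟨C, rfl, σ, hσ, hC⟩ := hS
  obtain ⟨C', hCC, σ', hσ', hC'⟩ := hS'
  obtain ⟨v, hv⟩ := Config.shape_eq.1 hCC.symm
  rw [hC, hC'] at hv
  have heq := comb_rigid hm hX hX' h0 hv
  have h1 := (mem_comb_stem (X := X) (fun i hi => stemOK_of_mem (hσ i hi)) (Or.inl rfl)).2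
    ⟨i, hi, rfl⟩
  rw [← heq, mem_comb_stem (fun i hi => stemOK_of_mem (hσ' i hi)) (Or.inl rfl)] at h1
  obtain ⟨j, hj, h⟩ := h1
  exact ⟨j, hj, by omega⟩

theorem stateA_mem : stateA ∈ states := by simp [states, stateA]

theorem stateB_mem : stateB ∈ states := by simp [states, stateB]

/-! ### Exponentially many nodes in one component -/

/-- The gadget states of a comb: `stateB` for the gadgets in `U`, and `stateA` for the others. -/
def choice (U : Finset ℕ) (i : ℕ) : ℕ := if i ∈ U then stateB else stateA

theorem choice_cases (U : Finset ℕ) (i : ℕ) : choice U i = stateA ∨ choice U i = stateB := by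
  unfold choice
  split_ifs <;> simp

theorem choice_footConnected (U : Finset ℕ) (i : ℕ) : footConnected (choice U i) = true := by
  rcases choice_cases U i with h | h <;> rw [h]
  · exact footConnected_stateA
  · exact footConnected_stateB

theorem choice_mem (U : Finset ℕ) (i : ℕ) : choice U i ∈ states := by
  rcases choice_cases U i with h | h <;> rw [h]
  · exact stateA_mem
  · exact stateB_mem

theorem choice_insert (U : Finset ℕ) (i : ℕ) :
    choice (insert i U) = Function.update (choice U) i stateB := by
  funext j
  by_cases hij : j = i
  · subst hij
    simp [choice]
  · simp [choice, hij]

/-- The comb with offsets `X` and gadget states `choice U`, as a configuration. -/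
noncomputable def combConfig {n m : ℕ} {X : ℕ → ℤ} (hm : 1 ≤ m) (hX : Spaced m X)
    (hn : (X (m - 1) + 1 - X 0).toNat + 46 * m = n) (U : Finset ℕ) : Config n :=
  ⟨comb m X (choice U), (card_comb hX fun i _ => choice_cases U i).trans hn,
    comb_connected hm hX fun i _ => choice_footConnected U i⟩

section

variable {n m : ℕ} {X : ℕ → ℤ} (hm : 1 ≤ m) (hX : Spaced m X)
  (hn : (X (m - 1) + 1 - X 0).toNat + 46 * m = n)

theorem combConfig_mem_combShapes (U : Finset ℕ) :
    (combConfig hm hX hn U).shape ∈ combShapes n m X :=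
  ⟨_, rfl, _, fun i _ => choice_mem U i, rfl⟩

/-- The shape of a comb with gadget states `choice U`, as a node that contains only pattern Z. -/
noncomputable def combNode (U : Finset ℕ) : onlyZShapes n :=
  ⟨(combConfig hm hX hn U).shape, _, rfl, comb_onlyZ hm hX fun i _ => choice_cases U i⟩

/-- Once translations are excluded by rigidity, the cell `(5, 7)` of gadget `i` tells whether `i`
has been switched. -/
theorem combNode_injOn : Set.InjOn (combNode hm hX hn) {U | U ⊆ Finset.range m} := by
  intro U hU U' hU' h
  obtain ⟨v, hv⟩ := Config.shape_eq.1 (congrArg Subtype.val h)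
  have heq : comb m X (choice U') = comb m X (choice U) := comb_rigid hm hX hX rfl hv
  have key : ∀ W : Finset ℕ, ∀ i < m,
      ((X i + 5, 1 + 7) ∈ comb m X (choice W) ↔ i ∉ W) := by
    intro W i hi
    rw [mem_comb_local hX hi (by norm_num) (by norm_num), choice]
    split_ifs with hW
    · simp only [hW, not_true_eq_false, iff_false]
      decide +kernel
    · simp only [hW, not_false_eq_true, iff_true]
      decide +kernel
  ext i
  by_cases hi : i < m
  · rw [← not_iff_not, ← key U i hi, ← key U' i hi, heq]
  · exact ⟨fun h => absurd (Finset.mem_range.1 (hU h)) hi,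
      fun h => absurd (Finset.mem_range.1 (hU' h)) hi⟩

theorem combNode_reachable (U : Finset ℕ) (hU : U ⊆ Finset.range m) :
    ((reconfGraph n).induce (onlyZShapes n)).Reachable (combNode hm hX hn ∅)
      (combNode hm hX hn U) := by
  induction U using Finset.induction with
  | empty => rfl
  | @insert i U hi ih =>
    rw [Finset.insert_subset_iff, Finset.mem_range] at hU
    refine (ih hU.2).trans ?_
    -- Adjacency requires distinct nodes; the case of equality is simply absorbed here.
    by_cases heq : combNode hm hX hn U = combNode hm hX hn (insert i U)
    · rw [heq]
    · refine SimpleGraph.Adj.reachable ?_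
      rw [SimpleGraph.comap_adj]
      refine (SimpleGraph.fromRel_adj _ _ _).2 ⟨fun h => heq (Subtype.ext h), Or.inl
        ⟨combConfig hm hX hn U, combConfig hm hX hn (insert i U), rfl, rfl, ?_⟩⟩
      have := comb_switch hm hX (fun i _ => choice_footConnected U i) hU.1
        (by simp [choice, hi])
      rwa [← choice_insert] at this

end

/-! ### Exponentially many components -/

/-- Offsets of `m` gadgets: gadget `i ∈ V` is displaced by one, and the last gadget by `r`. -/
def offset (m r : ℕ) (V : Finset ℕ) (i : ℕ) : ℤ :=
  20 * i + (if i ∈ V then 1 else 0) + (if i = m - 1 then (r : ℤ) else 0)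

theorem offset_spaced (m r : ℕ) (V : Finset ℕ) : Spaced m (offset m r V) := by
  intro i j hij hj
  unfold offset
  rw [if_neg (show i ≠ m - 1 by omega)]
  split_ifs <;> omega

theorem offset_zero {m r : ℕ} (hm : 2 ≤ m) {V : Finset ℕ} (hV : V ⊆ Finset.Ico 1 (m - 1)) :
    offset m r V 0 = 0 := by
  have h0 : 0 ∉ V := fun h => by simpa using hV h
  simp [offset, h0, show 0 ≠ m - 1 by omega]

/-- The set `V` avoids both end gadgets, so the length of the line, and with it the number of
modules, does not depend on `V`. -/
theorem offset_last {m r : ℕ} {V : Finset ℕ} (hV : V ⊆ Finset.Ico 1 (m - 1)) :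
    offset m r V (m - 1) = 20 * (m - 1 : ℕ) + r := by
  have h0 : m - 1 ∉ V := fun h => by simpa using hV h
  simp [offset, h0]

/-- Offsets of different gadgets differ by at least 19, so an equality of offsets matches each inner
gadget with itself and compares the displacements. -/
theorem subset_of_offset {m r : ℕ} {V V' : Finset ℕ} (hV : V ⊆ Finset.Ico 1 (m - 1))
    (h : ∀ i < m, ∃ j < m, offset m r V i = offset m r V' j) : V ⊆ V' := by
  intro i hi
  have hiV := Finset.mem_Ico.1 (hV hi)
  obtain ⟨j, hj, hij⟩ := h i (by omega)
  by_contra hi'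
  rw [offset, if_pos hi, if_neg (show i ≠ m - 1 by omega), offset] at hij
  by_cases hji : j = i
  · subst hji
    rw [if_neg hi', if_neg (show j ≠ m - 1 by omega)] at hij
    omega
  · split_ifs at hij <;> omega

theorem exists_rate : ∃ c : ℝ, 1 < c ∧ c ^ 200 = 2 := by
  refine ⟨(2 : ℝ) ^ ((1 : ℝ) / 200), Real.one_lt_rpow (by norm_num) (by norm_num), ?_⟩
  rw [← Real.rpow_natCast, ← Real.rpow_mul (by norm_num)]
  norm_num

/-- There are exponentially many locked components with exponentially many nodes that are connected
through configurations containing only pattern Z. -/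
theorem exists_many_locked_components :
    ∃ c : ℝ, 1 < c ∧ ∃ N : ℕ, ∀ n : ℕ, N ≤ n →
      HasAtLeast
        {K : (reconfGraph n).ConnectedComponent |
          (∀ S ∈ stripShapes n, S ∉ K.supp) ∧
          ∃ L : ((reconfGraph n).induce
              (onlyZShapes n)).ConnectedComponent,
            (∀ S ∈ L.supp, (S : Shape n) ∈ K.supp) ∧
            HasAtLeast L.supp (c ^ n)}
        (c ^ n) := by
  classical
  obtain ⟨c, hc1, hc⟩ := exists_rate
  refine ⟨c, hc1, 300, fun n hN => ?_⟩
  -- The gadgets have `46 * m` modules and the line has `20 * (m - 1) + r + 1`, so the total is `n`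
  -- exactly when `n + 19 = 66 * m + r`.
  obtain ⟨m, hm⟩ : ∃ m, m = (n + 19) / 66 := ⟨_, rfl⟩
  obtain ⟨r, hr⟩ : ∃ r, r = (n + 19) % 66 := ⟨_, rfl⟩
  have hm2 : 2 ≤ m := by omega
  have hm1 : 1 ≤ m := by omega
  have hcn : ∀ k, m - 2 ≤ k → c ^ n ≤ (2 : ℝ) ^ k := by
    intro k hk
    rw [← hc, ← pow_mul]
    -- From `300 ≤ n` follows `4 ≤ m`, and then `n ≤ 66 * m + 46 ≤ 200 * (m - 2)`; this is where the
    -- exponent 200 of the rate and the bound 300 are used.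
    exact pow_le_pow_right₀ hc1.le (by omega)
  have hX := offset_spaced m r
  have hn : ∀ V ⊆ Finset.Ico 1 (m - 1),
      (offset m r V (m - 1) + 1 - offset m r V 0).toNat + 46 * m = n := by
    intro V hV
    rw [offset_zero hm2 hV, offset_last hV]
    omega
  let comp : {V // V ∈ (Finset.Ico 1 (m - 1)).powerset} →
      (reconfGraph n).ConnectedComponent := fun V =>
    (reconfGraph n).connectedComponentMk
      (combConfig hm1 (hX V) (hn V (Finset.mem_powerset.1 V.2)) ∅).shape
  have hcomp : ∀ V, ∀ S ∈ (comp V).supp, S ∈ combShapes n m (offset m r V) := by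
    intro V S hS
    rw [SimpleGraph.ConnectedComponent.mem_supp_iff] at hS
    exact combShapes_of_reachable hm2 (hX V) (combConfig_mem_combShapes hm1 (hX V) _ ∅)
      (SimpleGraph.ConnectedComponent.exact hS).symm
  have hinj : Function.Injective comp := by
    intro V V' h
    have h1 := hcomp V _ SimpleGraph.ConnectedComponent.connectedComponentMk_mem
    have h2 := hcomp V' (combConfig hm1 (hX V) (hn V (Finset.mem_powerset.1 V.2)) ∅).shape (by
      rw [← h]
      exact SimpleGraph.ConnectedComponent.connectedComponentMk_mem)
    have hV := Finset.mem_powerset.1 V.2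
    have hV' := Finset.mem_powerset.1 V'.2
    have h0 := (offset_zero (r := r) hm2 hV).trans (offset_zero (r := r) hm2 hV').symm
    -- A component shared by two displacement sets contains a shape that is a comb for both, so the
    -- offsets agree.
    refine Subtype.ext (Finset.Subset.antisymm ?_ ?_)
    · exact subset_of_offset hV fun i hi => exists_combShapes_inter hm1 (hX V) (hX V') h0 h1 h2 hi
    · exact subset_of_offset hV' fun i hi =>
        exists_combShapes_inter hm1 (hX V') (hX V) h0.symm h2 h1 hi
  refine ⟨Finset.univ.map ⟨comp, hinj⟩, ?_, ?_⟩
  · rintro K hK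
    obtain ⟨V, -, rfl⟩ := Finset.mem_map.1 hK
    refine ⟨fun S hS hSK => combShapes_not_strip hm2 (hX V) (hcomp V S hSK) hS, ?_⟩
    have hnV := hn V (Finset.mem_powerset.1 V.2)
    refine ⟨SimpleGraph.connectedComponentMk _ (combNode hm1 (hX V) hnV ∅), ?_, ?_⟩
    · intro S hS
      rw [SimpleGraph.ConnectedComponent.mem_supp_iff] at hS ⊢
      exact SimpleGraph.ConnectedComponent.sound
        ((SimpleGraph.ConnectedComponent.exact hS).map (SimpleGraph.Embedding.induce _).toHom)
    · refine ⟨(Finset.range m).powerset.image (combNode hm1 (hX V) hnV), ?_, ?_⟩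
      · intro S hS
        obtain ⟨U, hU, rfl⟩ := Finset.mem_image.1 hS
        exact SimpleGraph.ConnectedComponent.sound
          (combNode_reachable hm1 (hX V) hnV U (Finset.mem_powerset.1 hU)).symm
      · rw [Finset.card_image_of_injOn, Finset.card_powerset, Finset.card_range]
        · exact_mod_cast hcn m (by omega)
        · intro U hU U' hU'
          exact combNode_injOn hm1 (hX V) hnV (Finset.mem_powerset.1 hU) (Finset.mem_powerset.1 hU')
  · rw [Finset.card_map, Finset.card_univ, Fintype.card_coe, Finset.card_powerset, Nat.card_Ico]
    exact_mod_cast hcn _ (by omega)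

end PivotingSquares

theorem mainTheorem7 :
    ∃ c : ℝ, 1 < c ∧ ∃ N : ℕ, ∀ n : ℕ, N ≤ n →
      PivotingSquares.HasAtLeast
        {K : (PivotingSquares.reconfGraph n).ConnectedComponent |
          (∀ S ∈ PivotingSquares.stripShapes n, S ∉ K.supp) ∧
          ∃ L : ((PivotingSquares.reconfGraph n).induce
              (PivotingSquares.onlyZShapes n)).ConnectedComponent,
            (∀ S ∈ L.supp, (S : PivotingSquares.Shape n) ∈ K.supp) ∧
            PivotingSquares.HasAtLeast L.supp (c ^ n)}
        (c ^ n) :=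
  PivotingSquares.exists_many_locked_components
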